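/- For a real number $x$ let $\|x\|$ be the distance from $x$ to the nearest integer. For real $\alpha$ and $t\ge 1$ put $$\psi_\alpha(t)=\min_{q\in\mathbb{Z},\ 1\le q\le t}\|q\alpha\|,\qquad I_\alpha(t)=\int_1^t\psi_\alpha(\xi)\,d\xi .$$ For irrational $\alpha$ let $1=q_0\le q_1<q_2<\cdots$ be the denominators of the convergents $p_\nu/q_\nu=[a_0;a_1,\ldots,a_\nu]$ of the regular continued fraction $\alpha=[a_0;a_1,a_2,\ldots]$, and for $t\ge 1$ let $N(\alpha,t)$ be the unique index $N\ge 0$ with $q_N\le t<q_{N+1}$. Then for Lebesgue-almost every real number $\alpha$ both of the following hold: 1) $\displaystyle\lim_{t\to\infty}\frac{I_\alpha(t)}{N(\alpha,t)}=\frac12$; 2) $\displaystyle\lim_{t\to\infty}\frac{I_\alpha(t)}{\ln t}=\frac{6\ln 2}{\pi^2}$. -/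

import Mathlib

open Filter Topology MeasureTheory

noncomputable section

/-- The distance from a real number to the nearest integer. -/
def distNearestInt (x : ℝ) : ℝ := |x - round x|

/-- The irrationality measure function: the minimum of the distances from `q * α` to the nearest
integer, over the integers `q` with `1 ≤ q ≤ t`. For `1 ≤ t` the set below is finite and nonempty,
so that its infimum is a minimum. -/
def irrMeasure (α t : ℝ) : ℝ :=
  sInf ((fun q : ℕ => distNearestInt (q * α)) '' {q : ℕ | 1 ≤ q ∧ (q : ℝ) ≤ t})

/-- The integral of the irrationality measure function over the interval from `1` to `t`. -/
def irrMeasureIntegral (α t : ℝ) : ℝ := ∫ ξ in (1 : ℝ)..t, irrMeasure α ξ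

/-- The denominator of the convergent with index `n` of the regular continued fraction of `α`;
the one with index `0` is `1`. -/
def convDenom (α : ℝ) (n : ℕ) : ℝ := (GenContFract.of α).dens n

/-- The index `N` for which `t` lies between the convergent denominators with indices `N`
(inclusive) and `N + 1` (exclusive). For irrational `α` and `1 ≤ t` there is exactly one such index,
see `convIndex_spec` and `convIndex_unique`. -/
def convIndex (α t : ℝ) : ℕ := sInf {N : ℕ | convDenom α N ≤ t ∧ t < convDenom α (N + 1)}

theorem convDenom_mono (α : ℝ) : Monotone (convDenom α) :=
  monotone_nat_of_le_succ fun _ => GenContFract.of_den_mono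

theorem convIndex_spec {α t : ℝ} (hα : Irrational α) (ht : 1 ≤ t) :
    convDenom α (convIndex α t) ≤ t ∧ t < convDenom α (convIndex α t + 1) := by
  have hne : {N : ℕ | convDenom α N ≤ t ∧ t < convDenom α (N + 1)}.Nonempty := by
    classical
    have hterm : ∀ n, ¬ (GenContFract.of α).TerminatedAt n := by
      intro n hn
      obtain ⟨r, hr⟩ := (GenContFract.terminates_iff_rat α).1 ⟨n, hn⟩
      exact hα ⟨r, hr.symm⟩
    have hunb : ∃ n, t < convDenom α n := by
      obtain ⟨n, hn⟩ := exists_nat_gt t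
      refine ⟨n + 5, hn.trans_le ?_⟩
      have h1 : ((Nat.fib (n + 5 + 1) : ℕ) : ℝ) ≤ convDenom α (n + 5) :=
        GenContFract.succ_nth_fib_le_of_nth_den (Or.inr (hterm _))
      have h2 : n ≤ Nat.fib (n + 5 + 1) :=
        le_trans (by omega) (Nat.le_fib_self (n := n + 5 + 1) (by omega))
      exact le_trans (by exact_mod_cast h2) h1
    have h0 : Nat.find hunb ≠ 0 := by
      intro h
      have := Nat.find_spec hunb
      rw [h] at this
      simp only [convDenom, GenContFract.zeroth_den_eq_one] at this
      linarith
    obtain ⟨m, hm⟩ := Nat.exists_eq_succ_of_ne_zero h0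
    refine ⟨m, ?_, ?_⟩
    · exact not_lt.1 (Nat.find_min hunb (m := m) (by omega))
    · have := Nat.find_spec hunb
      rwa [hm] at this
  exact Nat.sInf_mem hne

theorem convIndex_unique {α t : ℝ} {N : ℕ}
    (h : convDenom α N ≤ t ∧ t < convDenom α (N + 1)) : convIndex α t = N := by
  have hm : convDenom α (convIndex α t) ≤ t ∧ t < convDenom α (convIndex α t + 1) :=
    Nat.sInf_mem (s := {N : ℕ | convDenom α N ≤ t ∧ t < convDenom α (N + 1)}) ⟨N, h⟩
  rcases lt_trichotomy (convIndex α t) N with h1 | h1 | h1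
  · linarith [convDenom_mono α (show convIndex α t + 1 ≤ N from h1)]
  · exact h1
  · linarith [convDenom_mono α (show N + 1 ≤ convIndex α t from h1)]

end

/-! On `[q_k, q_{k+1})` the function `ψ_α` equals `|q_k α - p_k|`, so the integral is a sum of terms
`(q_{k+1} - q_k) |q_k α - p_k|`. Let `x_k` be the k-th remainder and `v_k = q_{k-1}/q_k` (`v_0 =
0`). Then `(x_k, v_k)` is the orbit of `({α}, 0)` under the natural extension `T` of the Gauss map,
and each term is `(1 - x_k)/(1 + x_k v_k)` plus a telescoping difference of bounded quantities
(`sum_eq_birkhoffSum`). Hence the integral is, up to a bounded error, a Birkhoff sum of length `N`.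
Likewise `ln q_n` is the Birkhoff sum of `ln(a + v)`, where `a` is the current partial quotient
(`log_cfDen`). For the invariant measure `dx dy/(1 + xy)^2`, of mass `ln 2`, the means are `1/2` and
`π²/(12 ln 2)`; their quotient gives the second limit.

The orbits needed start on the null set `y = 0`, so almost everywhere convergence in the plane is
not enough. But `T` contracts the fibres, and both observables are Lipschitz in `y`; whether their
Birkhoff sums are bounded above therefore depends on `x` only (`mem_birkhoffUnbdd_gaussExt_iff`).
The set of bad `x` is invariant under the Gauss map, hence null or conull by ergodicity
(`volume_eq_zero_or_of_gaussMap_invariant`). When the observable has negative mean, the maximal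
inequality (`setIntegral_birkhoffUnbdd_nonneg`) excludes conull. Shifting by constants and changing
sign turns this into convergence of the averages. -/

open scoped ENNReal

/-! ### A maximal ergodic inequality -/

/-- The points at which the Birkhoff sums of `f` are not bounded above. -/
def birkhoffUnbdd {X : Type*} (T : X → X) (f : X → ℝ) : Set X :=
  {x | ¬ BddAbove (Set.range fun n => birkhoffSum T f n x)}

/-- The maximum of zero and of the first `n` Birkhoff sums. -/
def birkhoffMax {X : Type*} (T : X → X) (f : X → ℝ) : ℕ → X → ℝ
  | 0, _ => 0
  | n + 1, x => max 0 (f x + birkhoffMax T f n (T x))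

section Maximal

variable {X : Type*} {T : X → X} {f : X → ℝ}

theorem birkhoffMax_nonneg (n : ℕ) (x : X) : 0 ≤ birkhoffMax T f n x := by
  cases n with
  | zero => exact le_rfl
  | succ n => exact le_max_left _ _

theorem birkhoffMax_le_succ (n : ℕ) (x : X) :
    birkhoffMax T f n x ≤ birkhoffMax T f (n + 1) x := by
  induction n generalizing x with
  | zero => exact le_max_left _ _
  | succ n ih => exact max_le_max le_rfl (by linarith [ih (T x)])

theorem birkhoffSum_le_birkhoffMax (n : ℕ) (x : X) :
    birkhoffSum T f n x ≤ birkhoffMax T f n x := by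
  induction n generalizing x with
  | zero => simp [birkhoffMax]
  | succ n ih =>
    rw [birkhoffSum_succ']
    exact le_max_of_le_right (by linarith [ih (T x)])

theorem tendsto_birkhoffMax_of_mem {x : X} (hx : x ∈ birkhoffUnbdd T f) :
    Tendsto (fun n => birkhoffMax T f n x) atTop atTop := by
  refine tendsto_atTop_atTop_of_monotone' (monotone_nat_of_le_succ fun n => birkhoffMax_le_succ n x)
    fun ⟨C, hC⟩ => hx ⟨C, ?_⟩
  rintro _ ⟨n, rfl⟩
  exact (birkhoffSum_le_birkhoffMax n x).trans (hC ⟨n, rfl⟩)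

theorem mem_birkhoffUnbdd_map_iff (x : X) :
    T x ∈ birkhoffUnbdd T f ↔ x ∈ birkhoffUnbdd T f := by
  refine not_congr ⟨fun ⟨C, hC⟩ => ⟨max 0 (f x + C), ?_⟩, fun ⟨C, hC⟩ => ⟨C - f x, ?_⟩⟩
  · rintro _ ⟨n, rfl⟩
    cases n with
    | zero => simp
    | succ n =>
      have := hC ⟨n, rfl⟩
      simp only [birkhoffSum_succ'] at this ⊢
      exact le_max_of_le_right (by linarith)
  · rintro _ ⟨n, rfl⟩
    have := hC ⟨n + 1, rfl⟩
    simp only [birkhoffSum_succ'] at this ⊢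
    linarith

variable [MeasurableSpace X] {μ : Measure X}

theorem measurable_birkhoffSum (hT : Measurable T) (hf : Measurable f) (n : ℕ) :
    Measurable (birkhoffSum T f n) := by
  unfold birkhoffSum
  exact Finset.measurable_fun_sum _ fun i _ => hf.comp (hT.iterate i)

theorem measurableSet_birkhoffUnbdd (hT : Measurable T) (hf : Measurable f) :
    MeasurableSet (birkhoffUnbdd T f) := by
  have : birkhoffUnbdd T f = (⋃ C : ℕ, ⋂ n, {x | birkhoffSum T f n x ≤ C})ᶜ := by
    ext x
    simp only [birkhoffUnbdd, Set.mem_ofPred_eq, Set.mem_compl_iff, Set.mem_iUnion, Set.mem_iInter]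
    refine not_congr ⟨fun ⟨C, hC⟩ => ?_, fun ⟨C, hC⟩ => ⟨C, ?_⟩⟩
    · obtain ⟨m, hm⟩ := exists_nat_ge C
      exact ⟨m, fun n => (hC ⟨n, rfl⟩).trans hm⟩
    · rintro _ ⟨n, rfl⟩
      exact hC n
  rw [this]
  exact (MeasurableSet.iUnion fun C => MeasurableSet.iInter fun n =>
    measurableSet_le (measurable_birkhoffSum hT hf n) measurable_const).compl

theorem integrable_birkhoffMax (hT : MeasurePreserving T μ μ) (hf : Integrable f μ) (n : ℕ) :
    Integrable (birkhoffMax T f n) μ := by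
  induction n with
  | zero => exact integrable_zero _ _ _
  | succ n ih =>
    exact (integrable_zero _ _ _).sup (hf.add (hT.integrable_comp_of_integrable ih))

/-- Writing `M_n` for `birkhoffMax`, invariance of `E` and of the measure turns the integral of
`M_{n+1} - M_n ∘ T` over `E` into that of `M_{n+1} - M_n ≥ 0`, while the integrand converges to `f`
on `E`. -/
theorem setIntegral_birkhoffUnbdd_nonneg (hT : MeasurePreserving T μ μ) (hf : Integrable f μ)
    (hfm : Measurable f) : 0 ≤ ∫ x in birkhoffUnbdd T f, f x ∂μ := by
  set E := birkhoffUnbdd T f with hE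
  have hEm : MeasurableSet E := measurableSet_birkhoffUnbdd hT.measurable hfm
  have hTE : T ⁻¹' E = E := by
    ext x; exact mem_birkhoffUnbdd_map_iff x
  have hTr : MeasurePreserving T (μ.restrict E) (μ.restrict E) := by
    have := hT.restrict_preimage hEm
    rwa [hTE] at this
  have hMi := integrable_birkhoffMax hT hf
  -- The integrand is `max (-M_n (T x)) (f x)`: it is dominated by `|f|` because `M_n ≥ 0`, and on
  -- `E` it eventually equals `f` because `M_n ∘ T` tends to infinity there.
  have hlim : Tendsto (fun n => ∫ x in E, (birkhoffMax T f (n + 1) x - birkhoffMax T f n (T x)) ∂μ)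
      atTop (𝓝 (∫ x in E, f x ∂μ)) := by
    refine tendsto_integral_of_dominated_convergence (fun x => |f x|) (fun n => ?_)
      hf.abs.integrableOn (fun n => ae_of_all _ fun x => ?_) ?_
    · exact ((hMi (n + 1)).sub (hT.integrable_comp_of_integrable (hMi n))).aestronglyMeasurable.restrict
    · have h0 := birkhoffMax_nonneg (T := T) (f := f) n (T x)
      simp only [birkhoffMax, Real.norm_eq_abs]
      rcases max_cases 0 (f x + birkhoffMax T f n (T x)) with ⟨h, h'⟩ | ⟨h, h'⟩ <;> rw [h]
      · rw [abs_of_nonpos (by linarith), abs_of_nonpos (by linarith)]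
        linarith
      · simp
    · refine (ae_restrict_iff' hEm).2 (ae_of_all _ fun x hx => ?_)
      have hx' : T x ∈ E := (mem_birkhoffUnbdd_map_iff x).2 hx
      refine tendsto_const_nhds.congr' ?_
      filter_upwards [(tendsto_birkhoffMax_of_mem hx').eventually_ge_atTop (-f x)] with n hn
      simp only [birkhoffMax]
      rw [max_eq_right (by linarith)]
      ring
  refine ge_of_tendsto' hlim fun n => ?_
  have hc : ∫ x in E, birkhoffMax T f n (T x) ∂μ = ∫ x in E, birkhoffMax T f n x ∂μ := by
    conv_rhs => rw [← hTr.map_eq]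
    rw [integral_map hTr.measurable.aemeasurable]
    rw [hTr.map_eq]
    exact (hMi n).aestronglyMeasurable.restrict
  have hci : Integrable (fun x => birkhoffMax T f n (T x)) (μ.restrict E) :=
    (hT.integrable_comp_of_integrable (hMi n)).restrict
  rw [integral_sub (hMi (n + 1)).restrict hci, hc, sub_nonneg]
  exact integral_mono (hMi n).restrict (hMi (n + 1)).restrict fun x => birkhoffMax_le_succ n x

theorem integral_nonneg_of_measure_compl_birkhoffUnbdd (hT : MeasurePreserving T μ μ)
    (hf : Integrable f μ) (hfm : Measurable f) (h : μ (birkhoffUnbdd T f)ᶜ = 0) :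
    0 ≤ ∫ x, f x ∂μ := by
  rw [← setIntegral_univ, ← setIntegral_congr_set (ae_eq_univ.2 h)]
  exact setIntegral_birkhoffUnbdd_nonneg hT hf hfm

end Maximal

/-! ### The Gauss map, its natural extension and the invariant measure -/

/-- The Gauss map. -/
noncomputable def gaussMap (x : ℝ) : ℝ := Int.fract x⁻¹

/-- The natural extension of the Gauss map. -/
noncomputable def gaussExt (p : ℝ × ℝ) : ℝ × ℝ := (Int.fract p.1⁻¹, (⌊p.1⁻¹⌋ + p.2)⁻¹)

/-- The inverse branches of the Gauss map. -/
noncomputable def gaussBranch (k : ℕ) (s : ℝ) : ℝ := (k + 1 + s)⁻¹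

/-- The density of the invariant measure of the natural extension. -/
noncomputable def gaussDensity (p : ℝ × ℝ) : ℝ≥0∞ := ENNReal.ofReal ((1 + p.1 * p.2) ^ 2)⁻¹

/-- The (unnormalised) invariant measure of the natural extension of the Gauss map. -/
noncomputable def gaussExtMeasure : Measure (ℝ × ℝ) :=
  ((volume.restrict (Set.Ioo 0 1)).prod (volume.restrict (Set.Ioo 0 1))).withDensity gaussDensity

theorem measurable_gaussBranch (k : ℕ) : Measurable (gaussBranch k) := by
  unfold gaussBranch; fun_prop

theorem measurable_gaussExt : Measurable gaussExt := by
  unfold gaussExt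
  have h : Measurable fun p : ℝ × ℝ => ((⌊p.1⁻¹⌋ : ℤ) : ℝ) :=
    (measurable_from_top (f := fun n : ℤ => (n : ℝ))).comp
      (Int.measurable_floor.comp measurable_fst.inv)
  exact (measurable_fract.comp measurable_fst.inv).prodMk (h.add measurable_snd).inv

theorem measurable_gaussDensity : Measurable gaussDensity := by
  unfold gaussDensity; fun_prop

theorem floor_inv_gaussBranch {k : ℕ} {s : ℝ} (hs : s ∈ Set.Ico (0 : ℝ) 1) :
    ⌊(gaussBranch k s)⁻¹⌋ = k + 1 := by
  rw [gaussBranch, inv_inv, Int.floor_eq_iff]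
  push_cast
  exact ⟨by linarith [hs.1], by linarith [hs.2]⟩

theorem gaussMap_gaussBranch {k : ℕ} {s : ℝ} (hs : s ∈ Set.Ico (0 : ℝ) 1) :
    gaussMap (gaussBranch k s) = s := by
  rw [gaussMap, Int.fract, floor_inv_gaussBranch hs, gaussBranch, inv_inv]
  push_cast
  ring

theorem gaussBranch_mem {k : ℕ} {s : ℝ} (hs : s ∈ Set.Ioo (0 : ℝ) 1) :
    gaussBranch k s ∈ Set.Ioo (0 : ℝ) 1 := by
  have hk : (0 : ℝ) ≤ k := k.cast_nonneg
  have := hs.1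
  exact ⟨by unfold gaussBranch; positivity, inv_lt_one_of_one_lt₀ (by linarith)⟩

theorem iUnion_image_gaussBranch :
    ⋃ k, gaussBranch k '' Set.Ico (0 : ℝ) 1 = Set.Ioc 0 1 := by
  ext x
  simp only [Set.mem_iUnion, Set.mem_image]
  constructor
  · rintro ⟨k, s, hs, rfl⟩
    have hk : (0 : ℝ) ≤ k := k.cast_nonneg
    have := hs.1
    exact ⟨by unfold gaussBranch; positivity, inv_le_one_of_one_le₀ (by linarith)⟩
  · intro hx
    have h1 : 1 ≤ x⁻¹ := (one_le_inv₀ hx.1).2 hx.2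
    have h2 : 1 ≤ ⌊x⁻¹⌋₊ := Nat.le_floor (by simpa using h1)
    refine ⟨⌊x⁻¹⌋₊ - 1, x⁻¹ - ⌊x⁻¹⌋₊, ⟨?_, ?_⟩, ?_⟩
    · linarith [Nat.floor_le (zero_le_one.trans h1)]
    · linarith [Nat.lt_floor_add_one x⁻¹]
    · rw [gaussBranch, Nat.cast_sub h2]
      simp

/-- Change of variables on each branch, with Jacobian `gaussBranch k s ^ 2`. The half-open interval
`[0, 1)` is used because its images tile `(0, 1]` exactly. -/
theorem setLIntegral_Ioo_eq_tsum_gaussBranch (G : ℝ → ℝ≥0∞) :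
    ∫⁻ x in Set.Ioo 0 1, G x =
      ∑' k : ℕ, ∫⁻ s in Set.Ioo 0 1, ENNReal.ofReal (gaussBranch k s ^ 2) * G (gaussBranch k s) := by
  have hinj : ∀ k, Set.InjOn (gaussBranch k) (Set.Ico 0 1) := fun k s hs t ht h => by
    rw [← gaussMap_gaussBranch hs, h, gaussMap_gaussBranch ht]
  have hder : ∀ k, ∀ s ∈ Set.Ico (0 : ℝ) 1,
      HasDerivWithinAt (gaussBranch k) (-gaussBranch k s ^ 2) (Set.Ico 0 1) s := by
    intro k s hs
    have hk : (0 : ℝ) ≤ k := k.cast_nonneg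
    have hne : (k : ℝ) + 1 + s ≠ 0 := by linarith [hs.1]
    have h := (((hasDerivAt_id s).const_add ((k : ℝ) + 1)).inv hne).hasDerivWithinAt
      (s := Set.Ico 0 1)
    refine h.congr_deriv ?_
    simp [gaussBranch, neg_div]
  rw [setLIntegral_congr Ioo_ae_eq_Ioc, ← iUnion_image_gaussBranch, lintegral_iUnion]
  · refine tsum_congr fun k => ?_
    rw [lintegral_image_eq_lintegral_abs_deriv_mul measurableSet_Ico (hder k) (hinj k),
      setLIntegral_congr Ioo_ae_eq_Ico]
    simp
  · intro k
    exact measurableSet_Ico.image_of_measurable_injOn (measurable_gaussBranch k) (hinj k)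
  · intro j k hjk
    refine Set.disjoint_left.2 ?_
    rintro _ ⟨s, hs, rfl⟩ ⟨t, ht, h⟩
    have h1 := floor_inv_gaussBranch (k := j) hs
    rw [← h, floor_inv_gaussBranch ht] at h1
    exact hjk (by omega)

theorem lintegral_gaussExtMeasure {F : ℝ × ℝ → ℝ≥0∞} (hF : Measurable F) :
    ∫⁻ p, F p ∂gaussExtMeasure =
      ∫⁻ x in Set.Ioo 0 1, ∫⁻ y in Set.Ioo 0 1, gaussDensity (x, y) * F (x, y) := by
  rw [gaussExtMeasure, lintegral_withDensity_eq_lintegral_mul _ measurable_gaussDensity hF,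
    lintegral_prod _ (measurable_gaussDensity.mul hF).aemeasurable]
  rfl

theorem lintegral_comp_gaussExt {F : ℝ × ℝ → ℝ≥0∞} (hF : Measurable F) :
    ∫⁻ p, F (gaussExt p) ∂gaussExtMeasure = ∫⁻ p, F p ∂gaussExtMeasure := by
  have hF' : Measurable fun p => F (gaussExt p) := hF.comp measurable_gaussExt
  have hm : Measurable fun p : ℝ × ℝ => gaussDensity p * F p := measurable_gaussDensity.mul hF
  have hm' : Measurable fun p : ℝ × ℝ => gaussDensity p * F (gaussExt p) :=
    measurable_gaussDensity.mul hF'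
  have hb := fun k => measurable_gaussBranch k
  -- Both Jacobian-times-density factors equal `(k + 1 + s + y)⁻²`. This symmetry in `s` and `y` is
  -- what makes the measure invariant: the branches are unfolded in `x` and refolded in `y`.
  have key : ∀ (k : ℕ), ∀ s ∈ Set.Ioo (0 : ℝ) 1, ∀ y ∈ Set.Ioo (0 : ℝ) 1,
      ENNReal.ofReal (gaussBranch k s ^ 2) *
        (gaussDensity (gaussBranch k s, y) * F (gaussExt (gaussBranch k s, y))) =
      ENNReal.ofReal (gaussBranch k y ^ 2) *
        (gaussDensity (s, gaussBranch k y) * F (s, gaussBranch k y)) := by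
    intro k s hs y hy
    have hk : (0 : ℝ) ≤ k := k.cast_nonneg
    have hs0 := hs.1
    have hy0 := hy.1
    have h1 : gaussExt (gaussBranch k s, y) = (s, gaussBranch k y) := by
      have h := gaussMap_gaussBranch (k := k) (Set.Ioo_subset_Ico_self hs)
      rw [gaussMap] at h
      simp only [gaussExt, h, floor_inv_gaussBranch (Set.Ioo_subset_Ico_self hs)]
      simp [gaussBranch]
    rw [h1, ← mul_assoc, ← mul_assoc]
    congr 1
    simp only [gaussDensity]
    rw [← ENNReal.ofReal_mul (by positivity), ← ENNReal.ofReal_mul (by positivity)]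
    congr 1
    simp only [gaussBranch]
    field_simp
    ring
  rw [lintegral_gaussExtMeasure hF', lintegral_gaussExtMeasure hF]
  calc ∫⁻ x in Set.Ioo 0 1, ∫⁻ y in Set.Ioo 0 1, gaussDensity (x, y) * F (gaussExt (x, y))
      = ∑' k : ℕ, ∫⁻ s in Set.Ioo 0 1, ∫⁻ y in Set.Ioo 0 1, ENNReal.ofReal (gaussBranch k s ^ 2) *
        (gaussDensity (gaussBranch k s, y) * F (gaussExt (gaussBranch k s, y))) := by
        rw [setLIntegral_Ioo_eq_tsum_gaussBranch]
        refine tsum_congr fun k => lintegral_congr fun s => ?_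
        rw [lintegral_const_mul]
        exact hm'.comp measurable_prodMk_left
    _ = ∑' k : ℕ, ∫⁻ s in Set.Ioo 0 1, ∫⁻ y in Set.Ioo 0 1, ENNReal.ofReal (gaussBranch k y ^ 2) *
        (gaussDensity (s, gaussBranch k y) * F (s, gaussBranch k y)) := by
        refine tsum_congr fun k => setLIntegral_congr_fun measurableSet_Ioo fun s hs =>
          setLIntegral_congr_fun measurableSet_Ioo fun y hy => key k s hs y hy
    _ = ∫⁻ s in Set.Ioo 0 1, ∑' k : ℕ, ∫⁻ y in Set.Ioo 0 1, ENNReal.ofReal (gaussBranch k y ^ 2) *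
        (gaussDensity (s, gaussBranch k y) * F (s, gaussBranch k y)) := by
        rw [lintegral_tsum]
        intro k
        refine (Measurable.lintegral_prod_right' (f := fun p : ℝ × ℝ =>
          ENNReal.ofReal (gaussBranch k p.2 ^ 2) *
          (gaussDensity (p.1, gaussBranch k p.2) * F (p.1, gaussBranch k p.2))) ?_).aemeasurable
        exact (((hb k).comp measurable_snd).pow_const 2).ennreal_ofReal.mul
          (hm.comp (measurable_fst.prodMk ((hb k).comp measurable_snd)))
    _ = _ := by
        refine lintegral_congr fun s => ?_
        rw [setLIntegral_Ioo_eq_tsum_gaussBranch]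

theorem measurePreserving_gaussExt :
    MeasurePreserving gaussExt gaussExtMeasure gaussExtMeasure := by
  refine ⟨measurable_gaussExt, Measure.ext fun s hs => ?_⟩
  rw [← lintegral_indicator_one hs, lintegral_map (measurable_one.indicator hs) measurable_gaussExt,
    lintegral_comp_gaussExt (measurable_one.indicator hs), lintegral_indicator_one hs]

/-- The density is at most 1 on the unit square. This gives finiteness, and carries null sets and
integrability over from Lebesgue measure. -/
theorem gaussExtMeasure_le :
    gaussExtMeasure ≤ (volume.restrict (Set.Ioo 0 1)).prod (volume.restrict (Set.Ioo 0 1)) := by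
  conv_rhs => rw [← withDensity_one (μ := (volume.restrict (Set.Ioo (0 : ℝ) 1)).prod
    (volume.restrict (Set.Ioo (0 : ℝ) 1)))]
  refine withDensity_mono ?_
  rw [Measure.prod_restrict]
  filter_upwards [ae_restrict_mem (measurableSet_Ioo.prod measurableSet_Ioo)] with p hp
  have := mul_pos hp.1.1 hp.2.1
  refine ENNReal.ofReal_le_one.2 (inv_le_one_of_one_le₀ ?_)
  nlinarith

instance isFiniteMeasure_gaussExtMeasure : IsFiniteMeasure gaussExtMeasure :=
  isFiniteMeasure_of_le _ gaussExtMeasure_le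

/-! ### Ergodicity of the Gauss map -/

/-- In the Euclidean metric the branch `k = 0` has derivative `-1` at `0`, so it does not contract
uniformly. In the coordinate `log (1 + s)` the derivative has modulus `(1 + s)/((k + 1 + s)(k + 2 +
s)) ≤ 1/2`. -/
theorem abs_log_one_add_gaussBranch_sub_le (k : ℕ) {s t : ℝ} (hs : 0 ≤ s) (ht : 0 ≤ t) :
    |Real.log (1 + gaussBranch k s) - Real.log (1 + gaussBranch k t)| ≤
      |Real.log (1 + s) - Real.log (1 + t)| / 2 := by
  wlog hst : s ≤ t generalizing s t
  · rw [abs_sub_comm, abs_sub_comm (Real.log (1 + s))]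
    exact this ht hs (le_of_not_ge hst)
  have hk : (0 : ℝ) ≤ k := k.cast_nonneg
  obtain ⟨d, rfl⟩ := exists_add_of_le hst
  have hd : 0 ≤ d := by linarith
  have hs1 : 0 < gaussBranch k s := by unfold gaussBranch; positivity
  have ht1 : 0 < gaussBranch k (s + d) := by unfold gaussBranch; positivity
  have hle : gaussBranch k (s + d) ≤ gaussBranch k s := by
    unfold gaussBranch
    exact inv_anti₀ (by positivity) (by linarith)
  have h1 : Real.log (1 + gaussBranch k (s + d)) ≤ Real.log (1 + gaussBranch k s) :=
    Real.log_le_log (by linarith) (by linarith)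
  have h2 : Real.log (1 + s) ≤ Real.log (1 + (s + d)) :=
    Real.log_le_log (by linarith) (by linarith)
  rw [abs_of_nonneg (by linarith), abs_of_nonpos (by linarith)]
  -- The contraction, exponentiated: the factor `1/2` becomes the square.
  have key : (1 + gaussBranch k s) ^ 2 * (1 + s) ≤
      (1 + gaussBranch k (s + d)) ^ 2 * (1 + (s + d)) := by
    unfold gaussBranch
    rw [← sub_nonneg]
    have h3 : (k : ℝ) + 1 + s ≠ 0 := by positivity
    have h4 : (k : ℝ) + 1 + (s + d) ≠ 0 := by positivity
    field_simp
    ring_nf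
    positivity
  have := Real.log_le_log (by positivity) key
  rw [Real.log_mul (by positivity) (by positivity), Real.log_mul (by positivity) (by positivity),
    Real.log_pow, Real.log_pow] at this
  push_cast at this
  linarith

theorem abs_log_one_add_sub_le_one {s t : ℝ} (hs : s ∈ Set.Icc (0 : ℝ) 1)
    (ht : t ∈ Set.Icc (0 : ℝ) 1) : |Real.log (1 + s) - Real.log (1 + t)| ≤ 1 := by
  have h : ∀ u ∈ Set.Icc (0 : ℝ) 1, 0 ≤ Real.log (1 + u) ∧ Real.log (1 + u) ≤ 1 := fun u hu =>
    ⟨Real.log_nonneg (by linarith [hu.1]),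
      (Real.log_le_sub_one_of_pos (by linarith [hu.1])).trans (by linarith [hu.2])⟩
  rw [abs_le]
  constructor <;> linarith [(h s hs).1, (h s hs).2, (h t ht).1, (h t ht).2]

theorem abs_sub_le_two_mul_abs_log {s t : ℝ} (hs : s ∈ Set.Icc (0 : ℝ) 1)
    (ht : t ∈ Set.Icc (0 : ℝ) 1) : |s - t| ≤ 2 * |Real.log (1 + s) - Real.log (1 + t)| := by
  wlog hst : s ≤ t generalizing s t
  · rw [abs_sub_comm, abs_sub_comm (Real.log (1 + s))]
    exact this ht hs (le_of_not_ge hst)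
  have hs0 := hs.1
  have ht1 := ht.2
  have h := Real.one_sub_inv_le_log_of_pos (x := (1 + t) / (1 + s)) (by
    have : 0 ≤ t := ht.1
    positivity)
  rw [Real.log_div (by linarith) (by linarith), inv_div] at h
  have h3 : (t - s) / 2 ≤ 1 - (1 + s) / (1 + t) := by
    rw [one_sub_div (by linarith)]
    calc (t - s) / 2 ≤ (t - s) / (1 + t) :=
          div_le_div_of_nonneg_left (by linarith) (by linarith [ht.1]) (by linarith)
      _ = _ := by ring
  rw [abs_of_nonpos (by linarith), abs_of_nonpos (by linarith)]
  linarith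

/-- The densities of the conditional distributions of the remainders of a continued fraction. -/
noncomputable def condDensity (v t : ℝ) : ℝ≥0∞ := ENNReal.ofReal ((1 + v) / (1 + v * t) ^ 2)

theorem measurable_condDensity (v : ℝ) : Measurable (condDensity v) := by
  unfold condDensity; fun_prop

theorem Measurable.condDensity_mul {G : ℝ → ℝ≥0∞} (hG : Measurable G) (v : ℝ) :
    Measurable fun t => condDensity v t * G t :=
  (measurable_condDensity v).mul hG

theorem lintegral_condDensity {v : ℝ} (hv : v ∈ Set.Icc (0 : ℝ) 1) :
    ∫⁻ t in Set.Ioo 0 1, condDensity v t = 1 := by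
  have hpos : ∀ t ∈ Set.Icc (0 : ℝ) 1, 0 < 1 + v * t := fun t ht => by
    nlinarith [mul_nonneg hv.1 ht.1]
  have hcont : ContinuousOn (fun t : ℝ => (1 + v) / (1 + v * t) ^ 2) (Set.Icc 0 1) := by
    refine ContinuousOn.div (by fun_prop) (by fun_prop) fun t ht => ?_
    have := hpos t ht
    positivity
  have hint : IntegrableOn (fun t : ℝ => (1 + v) / (1 + v * t) ^ 2) (Set.Ioo 0 1) :=
    hcont.integrableOn_Icc.mono_set Set.Ioo_subset_Icc_self
  unfold condDensity
  rw [← ofReal_integral_eq_lintegral_ofReal hint, ← integral_Ioc_eq_integral_Ioo,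
    ← intervalIntegral.integral_of_le zero_le_one,
    intervalIntegral.integral_eq_sub_of_hasDerivAt (f := fun t => t * (1 + v) / (1 + v * t))]
  · have : 1 + v ≠ 0 := by linarith [hv.1]
    simp [this]
  · intro t ht
    rw [Set.uIcc_of_le zero_le_one] at ht
    have h0 := (hpos t ht).ne'
    have h := ((hasDerivAt_id t).mul_const (1 + v)).div
      (((hasDerivAt_id t).const_mul v).const_add 1) h0
    refine h.congr_deriv ?_
    simp only [id]
    field_simp
    ring
  · exact (hcont.mono (by rw [Set.uIcc_of_le zero_le_one])).intervalIntegrable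
  · filter_upwards [ae_restrict_mem measurableSet_Ioo] with t ht
    have := hpos t (Set.Ioo_subset_Icc_self ht)
    have := hv.1
    simp only [Pi.zero_apply]
    positivity

theorem half_le_condDensity {v t : ℝ} (hv : v ∈ Set.Icc (0 : ℝ) 1) (ht : t ∈ Set.Icc (0 : ℝ) 1) :
    2⁻¹ ≤ condDensity v t := by
  have h : (2⁻¹ : ℝ≥0∞) = ENNReal.ofReal 2⁻¹ := by
    rw [ENNReal.ofReal_inv_of_pos two_pos]; simp
  rw [h]
  refine ENNReal.ofReal_le_ofReal ?_
  have h1 : 1 + v * t ≤ 1 + v := by nlinarith [hv.1, ht.2]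
  have h2 : 0 < 1 + v * t := by nlinarith [mul_nonneg hv.1 ht.1]
  rw [le_div_iff₀ (by positivity)]
  nlinarith [hv.2]

theorem gaussBranch_mem_Icc (k : ℕ) {v : ℝ} (hv : v ∈ Set.Icc (0 : ℝ) 1) :
    gaussBranch k v ∈ Set.Icc (0 : ℝ) 1 := by
  have hk : (0 : ℝ) ≤ k := k.cast_nonneg
  have := hv.1
  exact ⟨by unfold gaussBranch; positivity, inv_le_one_of_one_le₀ (by linarith)⟩

/-- The family of densities is closed under the branches: restricting to a branch and rescaling
replaces `v` by `gaussBranch k v`, with a weight that does not depend on `s`. The induction for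
ergodicity can thus run over all `v` at once. -/
theorem sq_gaussBranch_mul_condDensity (k : ℕ) {v s : ℝ} (hv : 0 ≤ v) (hs : 0 ≤ s) :
    ENNReal.ofReal (gaussBranch k s ^ 2) * condDensity v (gaussBranch k s) =
      ENNReal.ofReal ((1 + v) / ((k + 1 + v) * (k + 2 + v))) * condDensity (gaussBranch k v) s := by
  have hk : (0 : ℝ) ≤ k := k.cast_nonneg
  unfold condDensity
  rw [← ENNReal.ofReal_mul (by positivity), ← ENNReal.ofReal_mul (by positivity)]
  congr 1
  unfold gaussBranch
  field_simp
  ring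

theorem setLIntegral_condDensity_mul {v : ℝ} (hv : v ∈ Set.Icc (0 : ℝ) 1) {G : ℝ → ℝ≥0∞}
    (hG : Measurable G) :
    ∫⁻ t in Set.Ioo 0 1, condDensity v t * G t =
      ∑' k : ℕ, ENNReal.ofReal ((1 + v) / ((k + 1 + v) * (k + 2 + v))) *
        ∫⁻ t in Set.Ioo 0 1, condDensity (gaussBranch k v) t * G (gaussBranch k t) := by
  rw [setLIntegral_Ioo_eq_tsum_gaussBranch]
  refine tsum_congr fun k => ?_
  have hGk : Measurable fun t => G (gaussBranch k t) := hG.comp (measurable_gaussBranch k)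
  rw [← lintegral_const_mul _ (hGk.condDensity_mul _)]
  refine setLIntegral_congr_fun measurableSet_Ioo fun s hs => ?_
  rw [← mul_assoc, sq_gaussBranch_mul_condDensity k hv.1 hs.1.le, mul_assoc]

theorem tsum_condDensity_weight {v : ℝ} (hv : v ∈ Set.Icc (0 : ℝ) 1) :
    ∑' k : ℕ, ENNReal.ofReal ((1 + v) / ((k + 1 + v) * (k + 2 + v))) = 1 := by
  have h := setLIntegral_condDensity_mul hv (G := fun _ => 1) measurable_const
  simp only [mul_one, lintegral_condDensity hv,
    lintegral_condDensity (gaussBranch_mem_Icc _ hv)] at h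
  exact h.symm

theorem ae_restrict_Ioo_irrational : ∀ᵐ x : ℝ ∂(volume.restrict (Set.Ioo 0 1)), Irrational x := by
  refine ae_restrict_of_ae ?_
  have : (Set.range ((↑) : ℚ → ℝ)).Countable := Set.countable_range _
  filter_upwards [this.ae_notMem volume] with x hx using hx

theorem irrational_gaussBranch {k : ℕ} {s : ℝ} (hs : Irrational s) :
    Irrational (gaussBranch k s) := by
  unfold gaussBranch
  rw [irrational_inv_iff]
  have := hs.natCast_add (k + 1)
  push_cast at this
  exact this

section Invariant

variable {A : Set ℝ}

/-- An invariant set occupies a definite proportion of every such density, even against a test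
function `φ`. Each passage to the branches leaves the indicator of `A` unchanged and halves the
Lipschitz constant of `φ`, so `φ` becomes nearly constant. -/
theorem half_mul_setLIntegral_condDensity_le (hA : MeasurableSet A)
    (hinv : ∀ x ∈ Set.Ioo (0 : ℝ) 1, Irrational x → (gaussMap x ∈ A ↔ x ∈ A))
    (n : ℕ) {L v : ℝ} (hL : 0 ≤ L) (hv : v ∈ Set.Icc (0 : ℝ) 1) {φ : ℝ → ℝ≥0∞} (hφ : Measurable φ)
    (hLip : ∀ s ∈ Set.Ioo (0 : ℝ) 1, ∀ t ∈ Set.Ioo (0 : ℝ) 1,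
      φ s ≤ φ t + ENNReal.ofReal (L * |Real.log (1 + s) - Real.log (1 + t)|)) :
    volume (A ∩ Set.Ioo 0 1) / 2 * ∫⁻ t in Set.Ioo 0 1, condDensity v t * φ t ≤
      (∫⁻ t in Set.Ioo 0 1, condDensity v t * (A.indicator 1 t * φ t)) +
        ENNReal.ofReal (L / 2 ^ n) := by
  have hχ : Measurable (A.indicator (1 : ℝ → ℝ≥0∞)) := measurable_one.indicator hA
  have hχφ : Measurable fun t => A.indicator (1 : ℝ → ℝ≥0∞) t * φ t := hχ.mul hφ
  induction n generalizing L v φ with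
  | zero =>
    -- With no branching, `φ` varies by at most `L` since `(0, 1)` has diameter at most 1 in the
    -- logarithmic metric. The factor `1/2` is the lower bound of the density.
    have h1 : ∀ s ∈ Set.Ioo (0 : ℝ) 1, volume (A ∩ Set.Ioo 0 1) / 2 * φ s ≤
        (∫⁻ t in Set.Ioo 0 1, condDensity v t * (A.indicator 1 t * φ t)) + ENNReal.ofReal L := by
      intro s hs
      have hm2 := hχφ.condDensity_mul v
      calc volume (A ∩ Set.Ioo 0 1) / 2 * φ s
          = ∫⁻ t in Set.Ioo 0 1, 2⁻¹ * φ s * A.indicator 1 t := by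
            rw [lintegral_const_mul _ hχ, lintegral_indicator_one hA, Measure.restrict_apply hA,
              div_eq_mul_inv]
            ring
        _ ≤ ∫⁻ t in Set.Ioo 0 1, (condDensity v t * (A.indicator 1 t * φ t) +
              condDensity v t * ENNReal.ofReal L) := by
            refine setLIntegral_mono' measurableSet_Ioo fun t ht => ?_
            have hle : φ s ≤ φ t + ENNReal.ofReal L := by
              refine (hLip s hs t ht).trans (by
                gcongr
                exact mul_le_of_le_one_right hL (abs_log_one_add_sub_le_one
                  (Set.Ioo_subset_Icc_self hs) (Set.Ioo_subset_Icc_self ht)))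
            by_cases htA : t ∈ A
            · simp only [htA, Set.indicator_of_mem, Pi.one_apply, mul_one, one_mul]
              rw [← mul_add]
              exact mul_le_mul' (half_le_condDensity hv (Set.Ioo_subset_Icc_self ht)) hle
            · simp [htA]
        _ = _ := by
            rw [lintegral_add_left hm2, lintegral_mul_const _ (measurable_condDensity v),
              lintegral_condDensity hv, one_mul]
    calc volume (A ∩ Set.Ioo 0 1) / 2 * ∫⁻ t in Set.Ioo 0 1, condDensity v t * φ t
        = ∫⁻ s in Set.Ioo 0 1, condDensity v s * (volume (A ∩ Set.Ioo 0 1) / 2 * φ s) := by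
          rw [← lintegral_const_mul _ (hφ.condDensity_mul v)]
          exact lintegral_congr fun s => by ring
      _ ≤ ∫⁻ s in Set.Ioo 0 1, condDensity v s *
            ((∫⁻ t in Set.Ioo 0 1, condDensity v t * (A.indicator 1 t * φ t)) +
              ENNReal.ofReal L) :=
          setLIntegral_mono' measurableSet_Ioo fun s hs => mul_le_mul_right (h1 s hs) _
      _ = _ := by
          rw [lintegral_mul_const _ (measurable_condDensity v), lintegral_condDensity hv, one_mul]
          simp
  | succ n ih =>
    rw [setLIntegral_condDensity_mul hv hφ, setLIntegral_condDensity_mul hv hχφ,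
      ← ENNReal.tsum_mul_left]
    have hw : ENNReal.ofReal (L / 2 ^ (n + 1)) =
        ∑' k : ℕ, ENNReal.ofReal ((1 + v) / ((k + 1 + v) * (k + 2 + v))) *
          ENNReal.ofReal (L / 2 ^ (n + 1)) := by
      rw [ENNReal.tsum_mul_right, tsum_condDensity_weight hv, one_mul]
    rw [hw, ← ENNReal.tsum_add]
    refine ENNReal.tsum_le_tsum fun k => ?_
    rw [← mul_add, mul_left_comm]
    refine mul_le_mul_right ?_ _
    have hφk := hφ.comp (measurable_gaussBranch k)
    -- The contraction of the branch is what allows `L / 2` here.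
    have h := ih (L := L / 2) (v := gaussBranch k v) (φ := fun t => φ (gaussBranch k t))
      (by positivity) (gaussBranch_mem_Icc k hv) hφk
      (fun s hs t ht => by
        refine (hLip _ (gaussBranch_mem (k := k) hs) _ (gaussBranch_mem (k := k) ht)).trans ?_
        refine add_le_add le_rfl (ENNReal.ofReal_le_ofReal ?_)
        have := abs_log_one_add_gaussBranch_sub_le k hs.1.le ht.1.le
        calc L * |Real.log (1 + gaussBranch k s) - Real.log (1 + gaussBranch k t)|
            ≤ L * (|Real.log (1 + s) - Real.log (1 + t)| / 2) := by gcongr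
          _ = _ := by ring) (hχ.mul hφk)
    have hL2 : L / 2 / 2 ^ n = L / 2 ^ (n + 1) := by rw [pow_succ]; field_simp
    rw [hL2] at h
    refine h.trans (le_of_eq ?_)
    congr 1
    refine lintegral_congr_ae ?_
    filter_upwards [ae_restrict_Ioo_irrational, ae_restrict_mem measurableSet_Ioo] with s hs hsI
    have := hinv _ (gaussBranch_mem (k := k) hsI) (irrational_gaussBranch hs)
    rw [gaussMap_gaussBranch (Set.Ioo_subset_Ico_self hsI)] at this
    by_cases hsA : gaussBranch k s ∈ A
    · simp [hsA, this.2 hsA]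
    · simp [hsA, mt this.1 hsA]

/-- The Gauss map is ergodic. -/
theorem volume_eq_zero_or_of_gaussMap_invariant (hA : MeasurableSet A)
    (hinv : ∀ x ∈ Set.Ioo (0 : ℝ) 1, Irrational x → (gaussMap x ∈ A ↔ x ∈ A)) :
    volume (A ∩ Set.Ioo 0 1) = 0 ∨ volume (Set.Ioo 0 1 \ A) = 0 := by
  by_contra! hcon
  obtain ⟨hc, hc'⟩ := hcon
  have hfin : volume (Set.Ioo (0 : ℝ) 1 \ A) ≠ ⊤ :=
    ((measure_mono Set.sdiff_subset).trans_lt (by simp : volume (Set.Ioo (0 : ℝ) 1) < ⊤)).ne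
  -- If both pieces had positive measure, a closed `F` of positive measure would fit in the
  -- complement of `A`. Lipschitz approximations of its indicator as test functions then give
  -- `volume A / 2 * volume F ≤ volume (F ∩ A) = 0`.
  obtain ⟨F, hFA, hF, hFpos⟩ := (measurableSet_Ioo.diff hA).exists_lt_isClosed_of_ne_top hfin
    (pos_iff_ne_zero.2 hc')
  have hχ : Measurable (A.indicator (1 : ℝ → ℝ≥0∞)) := measurable_one.indicator hA
  have hkey : ∀ (δ : ℝ) (hδ : 0 < δ), volume (A ∩ Set.Ioo 0 1) / 2 *
      ∫⁻ t in Set.Ioo 0 1, (thickenedIndicator hδ F t : ℝ≥0∞) ≤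
      ∫⁻ t in A ∩ Set.Ioo 0 1, (thickenedIndicator hδ F t : ℝ≥0∞) := by
    intro δ hδ
    have hm : Measurable fun t => (thickenedIndicator hδ F t : ℝ≥0∞) :=
      (thickenedIndicator hδ F).continuous.measurable.coe_nnreal_ennreal
    -- At `v = 0` the density is that of Lebesgue measure. The factor 2 in `L` converts Euclidean
    -- distance to the logarithmic metric.
    have hn := fun n : ℕ => half_mul_setLIntegral_condDensity_le hA hinv n (L := 2 * δ⁻¹) (v := 0)
      (by positivity) (by simp) hm (fun s hs t ht => by
        have h1 := (lipschitzWith_thickenedIndicator hδ F).dist_le_mul s t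
        rw [NNReal.dist_eq, Real.dist_eq] at h1
        have h2 := (le_abs_self _).trans h1
        rw [NNReal.coe_inv, Real.coe_toNNReal _ hδ.le] at h2
        have h3 := abs_sub_le_two_mul_abs_log (Set.Ioo_subset_Icc_self hs)
          (Set.Ioo_subset_Icc_self ht)
        have h4 : δ⁻¹ * |s - t| ≤ 2 * δ⁻¹ * |Real.log (1 + s) - Real.log (1 + t)| := by
          rw [mul_comm 2, mul_assoc]
          gcongr
        rw [← ENNReal.ofReal_coe_nnreal, ← ENNReal.ofReal_coe_nnreal,
          ← ENNReal.ofReal_add (by positivity) (by positivity)]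
        exact ENNReal.ofReal_le_ofReal (by linarith))
    have hlim : Tendsto (fun n : ℕ => (∫⁻ t in Set.Ioo 0 1,
        condDensity 0 t * (A.indicator 1 t * (thickenedIndicator hδ F t : ℝ≥0∞))) +
        ENNReal.ofReal (2 * δ⁻¹ / 2 ^ n)) atTop (𝓝 ((∫⁻ t in Set.Ioo 0 1,
        condDensity 0 t * (A.indicator 1 t * (thickenedIndicator hδ F t : ℝ≥0∞))) +
        ENNReal.ofReal 0)) := by
      refine tendsto_const_nhds.add (ENNReal.tendsto_ofReal ?_)
      exact tendsto_const_nhds.div_atTop (tendsto_pow_atTop_atTop_of_one_lt one_lt_two)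
    have h := ge_of_tendsto' hlim hn
    simp only [condDensity, add_zero, zero_mul, one_pow, div_one, ENNReal.ofReal_one, one_mul,
      ENNReal.ofReal_zero] at h
    refine h.trans (le_of_eq ?_)
    rw [← setLIntegral_indicator hA]
    refine lintegral_congr fun t => ?_
    by_cases ht : t ∈ A <;> simp [ht]
  have hδpos : ∀ n : ℕ, (0 : ℝ) < 1 / (n + 1) := fun n => Nat.one_div_pos_of_nat
  have hlim := fun B : Set ℝ => fun hB : IsFiniteMeasure (volume.restrict B) =>
    tendsto_lintegral_thickenedIndicator_of_isClosed (volume.restrict B) hF hδpos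
      tendsto_one_div_add_atTop_nhds_zero_nat
  have hf1 : IsFiniteMeasure (volume.restrict (A ∩ Set.Ioo (0 : ℝ) 1)) :=
    ⟨by
      rw [Measure.restrict_apply_univ]
      exact (measure_mono Set.inter_subset_right).trans_lt
        (by simp : volume (Set.Ioo (0 : ℝ) 1) < ⊤)⟩
  have h := le_of_tendsto_of_tendsto' (ENNReal.Tendsto.const_mul (hlim (Set.Ioo 0 1) inferInstance)
    (Or.inr ?_)) (hlim _ hf1) fun n => hkey _ (hδpos n)
  · rw [Measure.restrict_apply hF.measurableSet, Measure.restrict_apply hF.measurableSet,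
      Set.inter_eq_left.2 (hFA.trans Set.sdiff_subset)] at h
    have h0 : F ∩ (A ∩ Set.Ioo 0 1) = ∅ := by
      ext x
      simp only [Set.mem_inter_iff, Set.mem_empty_iff_false, iff_false]
      exact fun hx => (hFA hx.1).2 hx.2.1
    rw [h0, measure_empty, nonpos_iff_eq_zero, mul_eq_zero] at h
    rcases h with h | h
    · simp at h; exact hc h
    · exact hFpos.ne' h
  · exact ENNReal.div_ne_top (by simpa using hf1.measure_univ_lt_top.ne) two_ne_zero

end Invariant

/-! ### Birkhoff averages on the line `y = 0` -/

theorem gaussMap_mem_of_irrational {x : ℝ} (hx : Irrational x) :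
    gaussMap x ∈ Set.Ioo (0 : ℝ) 1 ∧ Irrational (gaussMap x) := by
  have h : Irrational (gaussMap x) := by
    rw [gaussMap, Int.fract]
    exact hx.inv.sub_intCast _
  exact ⟨⟨lt_of_le_of_ne (Int.fract_nonneg _) h.ne_zero.symm, Int.fract_lt_one _⟩, h⟩

theorem exists_gaussExt_eq {x : ℝ} (hx : x ∈ Set.Ioo (0 : ℝ) 1) :
    ∃ k : ℕ, ⌊x⁻¹⌋ = k + 1 ∧ ∀ y, gaussExt (x, y) = (gaussMap x, gaussBranch k y) := by
  have h1 : 1 ≤ ⌊x⁻¹⌋ := Int.le_floor.2 (by exact_mod_cast (one_le_inv₀ hx.1).2 hx.2.le)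
  obtain ⟨k, hk⟩ := Int.eq_ofNat_of_zero_le (sub_nonneg.2 h1)
  have hk' : ⌊x⁻¹⌋ = k + 1 := by omega
  refine ⟨k, hk', fun y => ?_⟩
  simp only [gaussExt, gaussMap, gaussBranch, hk']
  push_cast
  rfl

/-- Two orbits over the same `x` use the same branches, so their fibre distance halves at every step
and the differences sum to at most `K (1 + 1/2 + 1/4 + ...) = 2K` times the initial one. -/
theorem abs_birkhoffSum_gaussExt_sub_le {f : ℝ × ℝ → ℝ} {K : ℝ}
    (hf : ∀ x ∈ Set.Ioo (0 : ℝ) 1, ∀ y ∈ Set.Icc (0 : ℝ) 1, ∀ z ∈ Set.Icc (0 : ℝ) 1,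
      |f (x, y) - f (x, z)| ≤ K * |Real.log (1 + y) - Real.log (1 + z)|)
    (n : ℕ) {x y z : ℝ} (hx : x ∈ Set.Ioo (0 : ℝ) 1) (hxi : Irrational x)
    (hy : y ∈ Set.Icc (0 : ℝ) 1) (hz : z ∈ Set.Icc (0 : ℝ) 1) :
    |birkhoffSum gaussExt f n (x, y) - birkhoffSum gaussExt f n (x, z)| ≤
      2 * K * |Real.log (1 + y) - Real.log (1 + z)| := by
  induction n generalizing x y z with
  | zero =>
    have := (abs_nonneg _).trans (hf x hx y hy z hz)
    simp only [birkhoffSum_zero, sub_self, abs_zero]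
    linarith
  | succ n ih =>
    obtain ⟨k, -, hk⟩ := exists_gaussExt_eq hx
    obtain ⟨hx1, hx2⟩ := gaussMap_mem_of_irrational hxi
    have h1 := hf x hx y hy z hz
    have h2 := ih hx1 hx2 (gaussBranch_mem_Icc k hy) (gaussBranch_mem_Icc k hz)
    have h3 := abs_log_one_add_gaussBranch_sub_le k hy.1 hz.1
    rw [birkhoffSum_succ', birkhoffSum_succ', hk, hk]
    rcases le_or_gt 0 K with hK | hK
    · have h4 := mul_le_mul_of_nonneg_left h3 (by positivity : 0 ≤ 2 * K)
      rw [add_sub_add_comm]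
      refine (abs_add_le _ _).trans ?_
      linarith
    -- A negative `K` forces `y = z`.
    · have h5 := (abs_nonneg _).trans h1
      have h6 : |Real.log (1 + y) - Real.log (1 + z)| = 0 :=
        le_antisymm (by nlinarith) (abs_nonneg _)
      have h7 : y = z := by
        have := abs_sub_le_two_mul_abs_log hy hz
        rw [h6, mul_zero] at this
        exact sub_eq_zero.1 (abs_nonpos_iff.1 this)
      rw [h7]
      simp

section Average

variable {f : ℝ × ℝ → ℝ} {K : ℝ}

theorem mem_birkhoffUnbdd_gaussExt_iff
    (hf : ∀ x ∈ Set.Ioo (0 : ℝ) 1, ∀ y ∈ Set.Icc (0 : ℝ) 1, ∀ z ∈ Set.Icc (0 : ℝ) 1,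
      |f (x, y) - f (x, z)| ≤ K * |Real.log (1 + y) - Real.log (1 + z)|)
    {x y z : ℝ} (hx : x ∈ Set.Ioo (0 : ℝ) 1) (hxi : Irrational x)
    (hy : y ∈ Set.Icc (0 : ℝ) 1) (hz : z ∈ Set.Icc (0 : ℝ) 1) :
    (x, y) ∈ birkhoffUnbdd gaussExt f ↔ (x, z) ∈ birkhoffUnbdd gaussExt f := by
  have key : ∀ y ∈ Set.Icc (0 : ℝ) 1, ∀ z ∈ Set.Icc (0 : ℝ) 1,
      BddAbove (Set.range fun n => birkhoffSum gaussExt f n (x, y)) →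
      BddAbove (Set.range fun n => birkhoffSum gaussExt f n (x, z)) := by
    rintro y hy z hz ⟨C, hC⟩
    refine ⟨C + 2 * K * |Real.log (1 + y) - Real.log (1 + z)|, ?_⟩
    rintro _ ⟨n, rfl⟩
    have h1 := hC ⟨n, rfl⟩
    have h2 := abs_le.1 (abs_birkhoffSum_gaussExt_sub_le hf n hx hxi hy hz)
    simp only at h1 ⊢
    linarith
  exact not_congr ⟨key y hy z hz, key z hz y hy⟩

/-- The bad set on the line `y = 0` is invariant because moving along a fibre does not matter. Were
it conull, the bad set in the square would be conull too, and the maximal inequality would give a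
nonnegative integral. -/
theorem ae_bddAbove_birkhoffSum_gaussExt (hfm : Measurable f) (hfi : Integrable f gaussExtMeasure)
    (hf : ∀ x ∈ Set.Ioo (0 : ℝ) 1, ∀ y ∈ Set.Icc (0 : ℝ) 1, ∀ z ∈ Set.Icc (0 : ℝ) 1,
      |f (x, y) - f (x, z)| ≤ K * |Real.log (1 + y) - Real.log (1 + z)|)
    (hneg : ∫ p, f p ∂gaussExtMeasure < 0) :
    ∀ᵐ x ∂(volume.restrict (Set.Ioo (0 : ℝ) 1)),
      BddAbove (Set.range fun n => birkhoffSum gaussExt f n (x, 0)) := by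
  set E := birkhoffUnbdd gaussExt f with hE
  have hEm : MeasurableSet E := measurableSet_birkhoffUnbdd measurable_gaussExt hfm
  set A : Set ℝ := {x | (x, (0 : ℝ)) ∈ E} with hA
  have hAm : MeasurableSet A := measurable_prodMk_right hEm
  have h0 : (0 : ℝ) ∈ Set.Icc (0 : ℝ) 1 := by simp
  have hinv : ∀ x ∈ Set.Ioo (0 : ℝ) 1, Irrational x → (gaussMap x ∈ A ↔ x ∈ A) := by
    intro x hx hxi
    obtain ⟨k, -, hk⟩ := exists_gaussExt_eq hx
    obtain ⟨hx1, hx2⟩ := gaussMap_mem_of_irrational hxi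
    have h1 := mem_birkhoffUnbdd_map_iff (T := gaussExt) (f := f) (x, 0)
    rw [hk] at h1
    exact (mem_birkhoffUnbdd_gaussExt_iff hf hx1 hx2 h0 (gaussBranch_mem_Icc k h0)).trans h1
  have hnull : volume (A ∩ Set.Ioo 0 1) = 0 := by
    refine (volume_eq_zero_or_of_gaussMap_invariant hAm hinv).resolve_right fun hc => ?_
    refine hneg.not_ge (integral_nonneg_of_measure_compl_birkhoffUnbdd measurePreserving_gaussExt
      hfi hfm ?_)
    have h1 : ∀ᵐ x ∂(volume.restrict (Set.Ioo (0 : ℝ) 1)), x ∈ A := by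
      rw [ae_restrict_iff' measurableSet_Ioo]
      filter_upwards [measure_eq_zero_iff_ae_notMem.1 hc] with x hx hxI
      by_contra hxA
      exact hx ⟨hxI, hxA⟩
    have h2 : ∀ᵐ p ∂((volume.restrict (Set.Ioo (0 : ℝ) 1)).prod
        (volume.restrict (Set.Ioo (0 : ℝ) 1))), p ∈ E := by
      filter_upwards [Measure.quasiMeasurePreserving_fst.ae h1,
        Measure.quasiMeasurePreserving_fst.ae ae_restrict_Ioo_irrational,
        Measure.quasiMeasurePreserving_fst.ae (ae_restrict_mem measurableSet_Ioo),
        Measure.quasiMeasurePreserving_snd.ae (ae_restrict_mem measurableSet_Ioo)]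
        with p hp1 hp2 hp3 hp4
      exact (mem_birkhoffUnbdd_gaussExt_iff hf hp3 hp2 h0 (Set.Ioo_subset_Icc_self hp4)).1 hp1
    exact (Measure.absolutelyContinuous_of_le gaussExtMeasure_le).ae_le h2
  rw [ae_restrict_iff' measurableSet_Ioo]
  filter_upwards [measure_eq_zero_iff_ae_notMem.1 hnull] with x hx hxI
  by_contra hxA
  exact hx ⟨hxA, hxI⟩

theorem ae_bddAbove_birkhoffSum_gaussExt_sub_mul (hfm : Measurable f)
    (hfi : Integrable f gaussExtMeasure)
    (hf : ∀ x ∈ Set.Ioo (0 : ℝ) 1, ∀ y ∈ Set.Icc (0 : ℝ) 1, ∀ z ∈ Set.Icc (0 : ℝ) 1,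
      |f (x, y) - f (x, z)| ≤ K * |Real.log (1 + y) - Real.log (1 + z)|) {c : ℝ}
    (hc : ∫ p, f p ∂gaussExtMeasure < c * gaussExtMeasure.real Set.univ) :
    ∀ᵐ x ∂(volume.restrict (Set.Ioo (0 : ℝ) 1)),
      ∃ C, ∀ n : ℕ, birkhoffSum gaussExt f n (x, 0) ≤ C + n * c := by
  have h := ae_bddAbove_birkhoffSum_gaussExt (f := fun p => f p - c) (K := K)
    (hfm.sub_const c) (hfi.sub (integrable_const c))
    (fun x hx y hy z hz => by simpa using hf x hx y hy z hz) (by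
      rw [integral_sub hfi (integrable_const c), integral_const, smul_eq_mul]
      linarith)
  filter_upwards [h] with x hx
  obtain ⟨C, hC⟩ := hx
  refine ⟨C, fun n => ?_⟩
  have h1 := hC ⟨n, rfl⟩
  have h2 : birkhoffSum gaussExt (fun p => f p - c) n (x, 0) =
      birkhoffSum gaussExt f n (x, 0) - n * c := by
    simp [birkhoffSum, Finset.sum_sub_distrib]
  simp only [h2] at h1
  linarith

theorem ae_tendsto_birkhoffSum_gaussExt_div (hfm : Measurable f)
    (hfi : Integrable f gaussExtMeasure)
    (hf : ∀ x ∈ Set.Ioo (0 : ℝ) 1, ∀ y ∈ Set.Icc (0 : ℝ) 1, ∀ z ∈ Set.Icc (0 : ℝ) 1,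
      |f (x, y) - f (x, z)| ≤ K * |Real.log (1 + y) - Real.log (1 + z)|)
    {m : ℝ} (hm : ∫ p, f p ∂gaussExtMeasure = m * gaussExtMeasure.real Set.univ)
    (hpos : 0 < gaussExtMeasure.real Set.univ) :
    ∀ᵐ x ∂(volume.restrict (Set.Ioo (0 : ℝ) 1)),
      Tendsto (fun n : ℕ => birkhoffSum gaussExt f n (x, 0) / n) atTop (𝓝 m) := by
  have hε : ∀ j : ℕ, (0 : ℝ) < 1 / (j + 1) := fun j => Nat.one_div_pos_of_nat
  -- Upper bounds for `f` and for `-f`, with slopes exceeding the means by `1/(j + 1)`, enclose the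
  -- averages; countably many `j` keep the exceptional set null.
  have h1 := ae_all_iff.2 fun j : ℕ => ae_bddAbove_birkhoffSum_gaussExt_sub_mul hfm hfi hf
    (c := m + 1 / (j + 1)) (by rw [hm]; nlinarith [hε j])
  have h2 := ae_all_iff.2 fun j : ℕ => ae_bddAbove_birkhoffSum_gaussExt_sub_mul (K := K)
    hfm.neg hfi.neg
    (fun x hx y hy z hz => by
      have := hf x hx y hy z hz
      rwa [abs_sub_comm, ← neg_sub_neg, abs_sub_comm, abs_sub_comm] at this)
    (c := -m + 1 / (j + 1)) (by
      simp only [Pi.neg_apply]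
      rw [integral_neg, hm]; nlinarith [hε j])
  filter_upwards [h1, h2] with x hx1 hx2
  rw [Metric.tendsto_atTop]
  intro ε hε0
  obtain ⟨j, hj⟩ := exists_nat_one_div_lt (half_pos hε0)
  obtain ⟨C, hC⟩ := hx1 j
  obtain ⟨D, hD⟩ := hx2 j
  obtain ⟨N, hN⟩ := exists_nat_gt (max (C / (ε / 2)) (D / (ε / 2)))
  refine ⟨N + 1, fun n hn => ?_⟩
  have hn0 : (0 : ℝ) < n := by exact_mod_cast (by omega : 0 < n)
  have hNn : (N : ℝ) ≤ n := by exact_mod_cast (by omega : N ≤ n)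
  have hC1 : C < n * (ε / 2) :=
    (div_lt_iff₀ (half_pos hε0)).1 ((le_max_left _ _).trans_lt (hN.trans_le hNn))
  have hD1 : D < n * (ε / 2) :=
    (div_lt_iff₀ (half_pos hε0)).1 ((le_max_right _ _).trans_lt (hN.trans_le hNn))
  have h3 := hC n
  have h4 := hD n
  have h5 : birkhoffSum gaussExt (-f) n (x, 0) = -birkhoffSum gaussExt f n (x, 0) := by
    simp [birkhoffSum]
  rw [h5] at h4
  have h6 := mul_lt_mul_of_pos_left hj hn0
  rw [Real.dist_eq, abs_lt, lt_sub_iff_add_lt, sub_lt_iff_lt_add, lt_div_iff₀ hn0, div_lt_iff₀ hn0]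
  constructor <;> nlinarith

end Average

/-! ### The means of the two observables -/

theorem toReal_gaussDensity (p : ℝ × ℝ) : (gaussDensity p).toReal = ((1 + p.1 * p.2) ^ 2)⁻¹ :=
  ENNReal.toReal_ofReal (by positivity)

theorem integrable_gaussDensity_mul {f : ℝ × ℝ → ℝ} (hf : Integrable f gaussExtMeasure) :
    Integrable (fun p : ℝ × ℝ => ((1 + p.1 * p.2) ^ 2)⁻¹ * f p)
      ((volume.restrict (Set.Ioo 0 1)).prod (volume.restrict (Set.Ioo 0 1))) := by
  have := (integrable_withDensity_iff_integrable_smul' measurable_gaussDensity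
    (ae_of_all _ fun _ => ENNReal.ofReal_lt_top)).1 hf
  simpa only [toReal_gaussDensity, smul_eq_mul] using this

theorem integral_gaussExtMeasure_eq (f : ℝ × ℝ → ℝ) :
    ∫ p, f p ∂gaussExtMeasure = ∫ p, ((1 + p.1 * p.2) ^ 2)⁻¹ * f p
      ∂((volume.restrict (Set.Ioo 0 1)).prod (volume.restrict (Set.Ioo 0 1))) := by
  rw [gaussExtMeasure, integral_withDensity_eq_integral_toReal_smul measurable_gaussDensity
    (ae_of_all _ fun _ => ENNReal.ofReal_lt_top)]
  simp only [toReal_gaussDensity, smul_eq_mul]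

theorem integral_gaussExtMeasure {f : ℝ × ℝ → ℝ} (hf : Integrable f gaussExtMeasure) :
    ∫ p, f p ∂gaussExtMeasure =
      ∫ x in Set.Ioo 0 1, ∫ y in Set.Ioo 0 1, ((1 + x * y) ^ 2)⁻¹ * f (x, y) := by
  rw [integral_gaussExtMeasure_eq, integral_prod _ (integrable_gaussDensity_mul hf)]

theorem integral_gaussExtMeasure_symm {f : ℝ × ℝ → ℝ} (hf : Integrable f gaussExtMeasure) :
    ∫ p, f p ∂gaussExtMeasure =
      ∫ y in Set.Ioo 0 1, ∫ x in Set.Ioo 0 1, ((1 + x * y) ^ 2)⁻¹ * f (x, y) := by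
  rw [integral_gaussExtMeasure_eq, integral_prod_symm _ (integrable_gaussDensity_mul hf)]

theorem setIntegral_Ioo_eq_of_hasDerivAt {F f : ℝ → ℝ}
    (hF : ∀ t ∈ Set.Icc (0 : ℝ) 1, HasDerivAt F (f t) t) (hf : ContinuousOn f (Set.Icc 0 1)) :
    ∫ t in Set.Ioo 0 1, f t = F 1 - F 0 := by
  rw [← integral_Ioc_eq_integral_Ioo, ← intervalIntegral.integral_of_le zero_le_one]
  rw [← Set.uIcc_of_le (zero_le_one' ℝ)] at hF hf
  exact intervalIntegral.integral_eq_sub_of_hasDerivAt hF hf.intervalIntegrable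

theorem setIntegral_inv_one_add_mul_sq {x : ℝ} (hx : 0 ≤ x) :
    ∫ y in Set.Ioo 0 1, ((1 + x * y) ^ 2)⁻¹ = (1 + x)⁻¹ := by
  have hpos : ∀ y ∈ Set.Icc (0 : ℝ) 1, 1 + x * y ≠ 0 := fun y hy => by
    have := mul_nonneg hx hy.1
    positivity
  -- The antiderivative vanishing at 0 avoids dividing by `x`, so `x = 0` needs no separate case.
  rw [setIntegral_Ioo_eq_of_hasDerivAt (F := fun y => y / (1 + x * y))]
  · simp
  · intro y hy
    have h0 := hpos y hy
    refine ((hasDerivAt_id y).div (((hasDerivAt_id y).const_mul x).const_add 1) h0).congr_deriv ?_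
    simp only [id]
    field_simp
    ring
  · exact ContinuousOn.inv₀ (by fun_prop) fun y hy => pow_ne_zero _ (hpos y hy)

theorem setIntegral_one_sub_div_cube {x : ℝ} (hx : 0 ≤ x) :
    ∫ y in Set.Ioo 0 1, ((1 + x * y) ^ 2)⁻¹ * ((1 - x) / (1 + x * y)) =
      (1 - x) * (2 + x) / (2 * (1 + x) ^ 2) := by
  have hpos : ∀ y ∈ Set.Icc (0 : ℝ) 1, 1 + x * y ≠ 0 := fun y hy => by
    have := mul_nonneg hx hy.1
    positivity
  rw [setIntegral_Ioo_eq_of_hasDerivAt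
    (F := fun y => (1 - x) * (y * (2 + x * y)) / (2 * (1 + x * y) ^ 2))]
  · simp
  · intro y hy
    have h0 := hpos y hy
    have h1 := ((hasDerivAt_id y).const_mul x).const_add 1
    have h2 := ((hasDerivAt_id y).const_mul x).const_add 2
    have h3 := (((hasDerivAt_id y).mul h2).const_mul (1 - x)).div ((h1.pow 2).const_mul 2)
      (mul_ne_zero two_ne_zero (pow_ne_zero 2 h0))
    refine h3.congr_deriv ?_
    simp only [id, Pi.mul_apply, Pi.pow_apply]
    field_simp
    ring
  · exact (ContinuousOn.inv₀ (by fun_prop) fun y hy => pow_ne_zero _ (hpos y hy)).mul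
      (ContinuousOn.div (by fun_prop) (by fun_prop) hpos)

theorem gaussExtMeasure_real_univ : gaussExtMeasure.real Set.univ = Real.log 2 := by
  have h := integral_gaussExtMeasure (f := fun _ => 1) (integrable_const 1)
  rw [integral_const, smul_eq_mul, mul_one] at h
  rw [h]
  simp only [mul_one]
  rw [setIntegral_congr_fun measurableSet_Ioo fun x hx => setIntegral_inv_one_add_mul_sq hx.1.le,
    setIntegral_Ioo_eq_of_hasDerivAt (F := fun x => Real.log (1 + x))]
  · norm_num
  · intro x hx
    have h0 : 1 + x ≠ 0 := by linarith [hx.1]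
    simpa using ((hasDerivAt_id x).const_add 1).log h0
  · exact ContinuousOn.inv₀ (by fun_prop) fun x hx => by linarith [hx.1]

theorem ae_gaussExtMeasure_mem :
    ∀ᵐ p ∂gaussExtMeasure, p ∈ Set.Ioo (0 : ℝ) 1 ×ˢ Set.Ioo (0 : ℝ) 1 := by
  refine (Measure.absolutelyContinuous_of_le gaussExtMeasure_le).ae_le ?_
  rw [Measure.prod_restrict]
  exact ae_restrict_mem (measurableSet_Ioo.prod measurableSet_Ioo)

theorem measurable_one_sub_div : Measurable fun p : ℝ × ℝ => (1 - p.1) / (1 + p.1 * p.2) := by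
  fun_prop

theorem integrable_one_sub_div :
    Integrable (fun p : ℝ × ℝ => (1 - p.1) / (1 + p.1 * p.2)) gaussExtMeasure := by
  refine Integrable.of_bound measurable_one_sub_div.aestronglyMeasurable 1 ?_
  filter_upwards [ae_gaussExtMeasure_mem] with p hp
  have h1 := mul_pos hp.1.1 hp.2.1
  have h2 := hp.1.1
  have h3 := hp.1.2
  rw [Real.norm_eq_abs, abs_of_nonneg (div_nonneg (by linarith) (by linarith)),
    div_le_one (by linarith)]
  linarith

theorem integral_one_sub_div :
    ∫ p, (1 - p.1) / (1 + p.1 * p.2) ∂gaussExtMeasure = 1 / 2 * gaussExtMeasure.real Set.univ := by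
  rw [integral_gaussExtMeasure integrable_one_sub_div, gaussExtMeasure_real_univ,
    setIntegral_congr_fun measurableSet_Ioo fun x hx => setIntegral_one_sub_div_cube hx.1.le,
    setIntegral_Ioo_eq_of_hasDerivAt
      (F := fun x => (Real.log (1 + x) - 2 / (1 + x) - x) / 2)]
  · norm_num
    ring
  · intro x hx
    have h0 : 1 + x ≠ 0 := by linarith [hx.1]
    have h1 := (hasDerivAt_id x).const_add 1
    refine ((((h1.log h0).sub ((hasDerivAt_const x 2).div h1 h0)).sub
      (hasDerivAt_id x)).div_const 2).congr_deriv ?_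
    simp only [id]
    field_simp
    ring
  · exact ContinuousOn.div (by fun_prop) (by fun_prop) fun x hx => by
      have := hx.1
      positivity

theorem integrableOn_pow_mul_neg_log (n : ℕ) :
    IntegrableOn (fun y : ℝ => y ^ n * -Real.log y) (Set.Ioo 0 1) := by
  have h : IntervalIntegrable (fun y : ℝ => y ^ n * -Real.log y) volume 0 1 :=
    intervalIntegral.intervalIntegrable_log'.neg.continuousOn_mul (by fun_prop)
  rw [intervalIntegrable_iff_integrableOn_Ioo_of_le zero_le_one] at h
  exact h

theorem setIntegral_pow_mul_neg_log (n : ℕ) :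
    ∫ y in Set.Ioo 0 1, y ^ n * -Real.log y = 1 / ((n : ℝ) + 1) ^ 2 := by
  rw [← integral_Ioc_eq_integral_Ioo, ← intervalIntegral.integral_of_le zero_le_one,
    intervalIntegral.integral_eq_sub_of_hasDerivAt_of_le zero_le_one
      (f := fun y => y ^ (n + 1) / ((n : ℝ) + 1) ^ 2 - y ^ n * (y * Real.log y) / (n + 1))]
  · simp
  · exact ((continuous_pow _).div_const _ |>.sub
      (((continuous_pow n).mul Real.continuous_mul_log).div_const _)).continuousOn
  · intro y hy
    have h0 : (n : ℝ) + 1 ≠ 0 := by positivity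
    have hy0 : y ≠ 0 := hy.1.ne'
    have h1 : HasDerivAt (fun y : ℝ => y ^ (n + 1) * Real.log y)
        (((n + 1 : ℕ) : ℝ) * y ^ n * Real.log y + y ^ (n + 1) * y⁻¹) y :=
      (hasDerivAt_pow (n + 1) y).mul (Real.hasDerivAt_log hy0)
    have h2 := ((hasDerivAt_pow (n + 1) y).div_const (((n : ℝ) + 1) ^ 2)).sub
      (h1.div_const ((n : ℝ) + 1))
    have h3 : (fun y : ℝ => y ^ (n + 1) / ((n : ℝ) + 1) ^ 2 - y ^ n * (y * Real.log y) / (n + 1)) =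
        (fun y : ℝ => y ^ (n + 1) / ((n : ℝ) + 1) ^ 2) -
          fun y : ℝ => y ^ (n + 1) * Real.log y / ((n : ℝ) + 1) := by
      ext y
      simp only [Pi.sub_apply]
      ring
    rw [h3]
    refine h2.congr_deriv ?_
    rw [Nat.add_sub_cancel]
    push_cast
    field_simp
    ring
  · rw [intervalIntegrable_iff_integrableOn_Ioo_of_le zero_le_one]
    exact integrableOn_pow_mul_neg_log n

theorem hasSum_one_div_succ_sq : HasSum (fun n : ℕ => 1 / ((n : ℝ) + 1) ^ 2) (Real.pi ^ 2 / 6) := by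
  have h := (hasSum_nat_add_iff' 1).2 hasSum_zeta_two
  simpa using h

/-- Splitting `ζ(2) = π²/6` by parity gives `π²/8` and `π²/24`; the difference is `π²/12`. -/
theorem hasSum_alternating_one_div_succ_sq :
    HasSum (fun n : ℕ => (-1) ^ n * (1 / ((n : ℝ) + 1) ^ 2)) (Real.pi ^ 2 / 12) := by
  set u : ℕ → ℝ := fun n => 1 / ((n : ℝ) + 1) ^ 2 with hu
  have hZ : HasSum u (Real.pi ^ 2 / 6) := hasSum_one_div_succ_sq
  have hodd : HasSum (fun k : ℕ => u (2 * k + 1)) (Real.pi ^ 2 / 6 / 4) := by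
    have h : (fun k : ℕ => u (2 * k + 1)) = fun k => u k / 4 := by
      ext k
      simp only [hu]
      push_cast
      field_simp
      ring
    rw [h]
    exact hZ.div_const 4
  have hs : Summable fun k : ℕ => u (2 * k) :=
    hZ.summable.comp_injective (mul_right_injective₀ two_ne_zero)
  have heq := (hs.hasSum.even_add_odd hodd).unique hZ
  have heven : HasSum (fun k : ℕ => u (2 * k)) (Real.pi ^ 2 / 8) := by
    have := hs.hasSum
    rwa [show ∑' k : ℕ, u (2 * k) = Real.pi ^ 2 / 8 by linarith] at this
  have h := HasSum.even_add_odd (f := fun n : ℕ => (-1) ^ n * u n)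
    (m := Real.pi ^ 2 / 8) (m' := -(Real.pi ^ 2 / 6 / 4))
    (by simpa only [pow_mul, neg_one_sq, one_pow, one_mul] using heven)
    (by simpa only [pow_add, pow_mul, neg_one_sq, one_pow, pow_one, one_mul, neg_one_mul] using hodd.neg)
  rwa [show Real.pi ^ 2 / 8 + -(Real.pi ^ 2 / 6 / 4) = Real.pi ^ 2 / 12 by ring] at h

/-- Expand `1/(1 + y)` as a geometric series; the interchange is justified by the convergence of `∑
1/(n + 1)²`. -/
theorem setIntegral_neg_log_div_one_add :
    ∫ y in Set.Ioo 0 1, (1 + y)⁻¹ * -Real.log y = Real.pi ^ 2 / 12 := by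
  have hint : ∀ n : ℕ, Integrable (fun y : ℝ => (-1) ^ n * (y ^ n * -Real.log y))
      (volume.restrict (Set.Ioo 0 1)) := fun n =>
    (integrableOn_pow_mul_neg_log n).integrable.const_mul _
  have hval : ∀ n : ℕ, ∫ y in Set.Ioo 0 1, (-1) ^ n * (y ^ n * -Real.log y) =
      (-1) ^ n * (1 / ((n : ℝ) + 1) ^ 2) := fun n => by
    rw [integral_const_mul, setIntegral_pow_mul_neg_log]
  have hnorm : ∀ n : ℕ, ∫ y in Set.Ioo 0 1, ‖(-1) ^ n * (y ^ n * -Real.log y)‖ =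
      1 / ((n : ℝ) + 1) ^ 2 := fun n => by
    rw [← setIntegral_pow_mul_neg_log]
    refine setIntegral_congr_fun measurableSet_Ioo fun y hy => ?_
    have := Real.log_nonpos hy.1.le hy.2.le
    have h2 := hy.1
    simp only [norm_mul, norm_pow, norm_neg, norm_one, one_pow, one_mul]
    rw [Real.norm_of_nonneg h2.le, Real.norm_of_nonpos this]
  have h := hasSum_integral_of_summable_integral_norm hint (by
    simp only [hnorm]; exact hasSum_one_div_succ_sq.summable)
  simp only [hval] at h
  rw [← h.unique hasSum_alternating_one_div_succ_sq]
  refine setIntegral_congr_fun measurableSet_Ioo fun y hy => ?_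
  have h1 : ∀ n : ℕ, (-1) ^ n * (y ^ n * -Real.log y) = (-y) ^ n * -Real.log y := fun n => by
    rw [← mul_assoc, ← mul_pow, neg_one_mul]
  simp only [h1]
  rw [tsum_mul_right, tsum_geometric_of_abs_lt_one (by rw [abs_neg, abs_of_pos hy.1]; exact hy.2),
    sub_neg_eq_add]

theorem measurable_log_floor_inv_add :
    Measurable fun p : ℝ × ℝ => Real.log (⌊p.1⁻¹⌋ + p.2) := by
  have h : (fun p : ℝ × ℝ => Real.log (⌊p.1⁻¹⌋ + p.2)) = fun p => -Real.log (gaussExt p).2 := by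
    ext p
    rw [gaussExt, Real.log_inv, neg_neg]
  rw [h]
  exact (Real.measurable_log.comp (measurable_snd.comp measurable_gaussExt)).neg

theorem integrable_neg_log_snd : Integrable (fun p : ℝ × ℝ => -Real.log p.2) gaussExtMeasure := by
  have h := integrableOn_pow_mul_neg_log 0
  simp only [pow_zero, one_mul] at h
  have h' : Integrable (fun p : ℝ × ℝ => -Real.log p.2)
      ((volume.restrict (Set.Ioo 0 1)).prod (volume.restrict (Set.Ioo 0 1))) :=
    Integrable.comp_snd h.integrable (volume.restrict (Set.Ioo 0 1))
  exact h'.mono_measure gaussExtMeasure_le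

theorem integral_neg_log_snd :
    ∫ p, -Real.log p.2 ∂gaussExtMeasure = Real.pi ^ 2 / 12 := by
  rw [integral_gaussExtMeasure_symm integrable_neg_log_snd, ← setIntegral_neg_log_div_one_add]
  refine setIntegral_congr_fun measurableSet_Ioo fun y hy => ?_
  simp only
  rw [integral_mul_const]
  simp only [mul_comm _ y]
  rw [setIntegral_inv_one_add_mul_sq hy.1.le]

theorem integrable_log_floor_inv_add :
    Integrable (fun p : ℝ × ℝ => Real.log (⌊p.1⁻¹⌋ + p.2)) gaussExtMeasure := by
  have h := measurePreserving_gaussExt.integrable_comp_of_integrable integrable_neg_log_snd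
  refine h.congr (ae_of_all _ fun p => ?_)
  simp [gaussExt]

/-- The observable is `-log y` composed with `gaussExt`, so by invariance its integral is that of
`-log y`, for which integrating over `x` first leaves `-log y / (1 + y)`. -/
theorem integral_log_floor_inv_add :
    ∫ p, Real.log (⌊p.1⁻¹⌋ + p.2) ∂gaussExtMeasure =
      Real.pi ^ 2 / (12 * Real.log 2) * gaussExtMeasure.real Set.univ := by
  have h2 : Real.log 2 ≠ 0 := (Real.log_pos one_lt_two).ne'
  rw [gaussExtMeasure_real_univ]
  have h : ∫ p, -Real.log (gaussExt p).2 ∂gaussExtMeasure = Real.pi ^ 2 / 12 := by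
    rw [← integral_neg_log_snd]
    conv_rhs => rw [← measurePreserving_gaussExt.map_eq]
    rw [integral_map measurable_gaussExt.aemeasurable]
    rw [measurePreserving_gaussExt.map_eq]
    exact integrable_neg_log_snd.aestronglyMeasurable
  simp only [gaussExt, Real.log_inv, neg_neg] at h
  rw [h]
  field_simp

theorem ae_tendsto_birkhoffSum_one_sub_div :
    ∀ᵐ x ∂(volume.restrict (Set.Ioo (0 : ℝ) 1)),
      Tendsto (fun n : ℕ => birkhoffSum gaussExt
        (fun p : ℝ × ℝ => (1 - p.1) / (1 + p.1 * p.2)) n (x, 0) / n) atTop (𝓝 (1 / 2)) := by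
  -- The observable is 1-Lipschitz in `y`; the 2 comes from passing to the logarithmic metric.
  refine ae_tendsto_birkhoffSum_gaussExt_div (K := 2) measurable_one_sub_div integrable_one_sub_div
    (fun x hx y hy z hz => (le_trans ?_ (abs_sub_le_two_mul_abs_log hy hz))) integral_one_sub_div
    (by rw [gaussExtMeasure_real_univ]; exact Real.log_pos one_lt_two)
  have hxy := mul_nonneg hx.1.le hy.1
  have hxz := mul_nonneg hx.1.le hz.1
  have h1 : (1 - x) / (1 + x * y) - (1 - x) / (1 + x * z) =
      (1 - x) * x / ((1 + x * y) * (1 + x * z)) * (z - y) := by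
    field_simp
    ring
  have h3 := hx.1
  have h4 : 0 ≤ 1 - x := by linarith [hx.2]
  simp only
  rw [h1, abs_mul, abs_sub_comm z y, abs_of_nonneg (by positivity)]
  refine mul_le_of_le_one_left (abs_nonneg _) (div_le_one_of_le₀ ?_ (by positivity))
  nlinarith [mul_nonneg hxy hxz]

theorem ae_tendsto_birkhoffSum_log :
    ∀ᵐ x ∂(volume.restrict (Set.Ioo (0 : ℝ) 1)),
      Tendsto (fun n : ℕ => birkhoffSum gaussExt
        (fun p : ℝ × ℝ => Real.log (⌊p.1⁻¹⌋ + p.2)) n (x, 0) / n) atTop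
        (𝓝 (Real.pi ^ 2 / (12 * Real.log 2))) := by
  refine ae_tendsto_birkhoffSum_gaussExt_div (K := 2) measurable_log_floor_inv_add
    integrable_log_floor_inv_add
    (fun x hx y hy z hz => (le_trans ?_ (abs_sub_le_two_mul_abs_log hy hz)))
    integral_log_floor_inv_add
    (by rw [gaussExtMeasure_real_univ]; exact Real.log_pos one_lt_two)
  obtain ⟨k, hk, -⟩ := exists_gaussExt_eq hx
  have hk0 : (0 : ℝ) ≤ k := k.cast_nonneg
  have key : ∀ y ∈ Set.Icc (0 : ℝ) 1, ∀ z ∈ Set.Icc (0 : ℝ) 1,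
      Real.log (⌊x⁻¹⌋ + y) - Real.log (⌊x⁻¹⌋ + z) ≤ |y - z| := by
    intro y hy z hz
    rw [hk]
    push_cast
    have hy0 := hy.1
    have hz0 := hz.1
    rw [← Real.log_div (by positivity) (by positivity)]
    refine (Real.log_le_sub_one_of_pos (by positivity)).trans ?_
    rw [div_sub_one (by positivity)]
    calc ((k : ℝ) + 1 + y - (k + 1 + z)) / (k + 1 + z) ≤ |y - z| / (k + 1 + z) := by
          gcongr
          rw [add_sub_add_left_eq_sub]
          exact le_abs_self _
      _ ≤ |y - z| := div_le_self (abs_nonneg _) (by linarith)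
  rw [abs_le]
  constructor
  · have := key z hz y hy
    rw [abs_sub_comm] at this
    linarith
  · exact key y hy z hz

/-! ### Arithmetic of the convergents -/

/-- The complete remainders of the continued fraction of `α`. -/
noncomputable def cfRem (α : ℝ) (n : ℕ) : ℝ := gaussMap^[n] (Int.fract α)

/-- The partial quotients of the continued fraction of `α`, from the one with index `1` on. -/
noncomputable def cfQuot (α : ℝ) (n : ℕ) : ℤ := ⌊(cfRem α n)⁻¹⌋

/-- The denominators of the convergents of `α` as integers. -/
noncomputable def cfDen (α : ℝ) : ℕ → ℤ
  | 0 => 1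
  | 1 => cfQuot α 0
  | n + 2 => cfQuot α (n + 1) * cfDen α (n + 1) + cfDen α n

/-- The numerators of the convergents of `α` as integers. -/
noncomputable def cfNum (α : ℝ) : ℕ → ℤ
  | 0 => ⌊α⌋
  | 1 => cfQuot α 0 * ⌊α⌋ + 1
  | n + 2 => cfQuot α (n + 1) * cfNum α (n + 1) + cfNum α n

/-- The signed errors of the convergents of `α`. -/
noncomputable def cfErr (α : ℝ) (n : ℕ) : ℝ := cfDen α n * α - cfNum α n

/-- The ratios of the consecutive denominators of the convergents of `α`. -/
noncomputable def cfRatio (α : ℝ) (n : ℕ) : ℝ := (gaussExt^[n] (Int.fract α, 0)).2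

theorem cfRem_succ (α : ℝ) (n : ℕ) : cfRem α (n + 1) = Int.fract (cfRem α n)⁻¹ :=
  Function.iterate_succ_apply' _ _ _

theorem gaussExt_iterate (α : ℝ) (n : ℕ) :
    gaussExt^[n] (Int.fract α, 0) = (cfRem α n, cfRatio α n) := by
  refine Prod.ext ?_ rfl
  induction n with
  | zero => rfl
  | succ n ih =>
    rw [Function.iterate_succ_apply']
    simp only at ih ⊢
    rw [cfRem_succ, ← ih]
    rfl

theorem cfRatio_succ (α : ℝ) (n : ℕ) :
    cfRatio α (n + 1) = (cfQuot α n + cfRatio α n)⁻¹ := by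
  rw [cfRatio, Function.iterate_succ_apply', gaussExt_iterate]
  rfl

section Irrational

variable {α : ℝ}

theorem cfRem_mem (hα : Irrational α) (n : ℕ) :
    cfRem α n ∈ Set.Ioo (0 : ℝ) 1 ∧ Irrational (cfRem α n) := by
  induction n with
  | zero =>
    have h : Irrational (Int.fract α) := hα.sub_intCast _
    exact ⟨⟨lt_of_le_of_ne (Int.fract_nonneg _) h.ne_zero.symm, Int.fract_lt_one _⟩, h⟩
  | succ n ih =>
    rw [cfRem_succ]
    exact gaussMap_mem_of_irrational ih.2

theorem cfRem_pos (hα : Irrational α) (n : ℕ) : 0 < cfRem α n := (cfRem_mem hα n).1.1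

theorem one_le_cfQuot (hα : Irrational α) (n : ℕ) : 1 ≤ cfQuot α n := by
  have h := (cfRem_mem hα n).1
  exact Int.le_floor.2 (by exact_mod_cast (one_le_inv₀ h.1).2 h.2.le)

theorem cfQuot_add_cfRem (α : ℝ) (n : ℕ) : cfQuot α n + cfRem α (n + 1) = (cfRem α n)⁻¹ := by
  rw [cfRem_succ]
  exact Int.floor_add_fract _

theorem cfDen_pos (hα : Irrational α) (n : ℕ) : 0 < cfDen α n := by
  induction n using Nat.twoStepInduction with
  | zero => exact one_pos
  | one => exact one_le_cfQuot hα 0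
  | more n h1 h2 =>
    have := mul_pos (one_le_cfQuot hα (n + 1)) h2
    simp only [cfDen]
    linarith

theorem cfRatio_nonneg (hα : Irrational α) (n : ℕ) : 0 ≤ cfRatio α n := by
  induction n with
  | zero => exact le_rfl
  | succ n ih =>
    have : (1 : ℝ) ≤ cfQuot α n := by exact_mod_cast one_le_cfQuot hα n
    rw [cfRatio_succ]
    positivity

theorem intFractPair_stream_eq (hα : Irrational α) (n : ℕ) :
    ∃ b, GenContFract.IntFractPair.stream α n = some ⟨b, cfRem α n⟩ := by
  induction n with
  | zero => exact ⟨⌊α⌋, rfl⟩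
  | succ n ih =>
    obtain ⟨b, hb⟩ := ih
    refine ⟨⌊(cfRem α n)⁻¹⌋, ?_⟩
    rw [GenContFract.IntFractPair.stream_succ_of_some hb (cfRem_pos hα n).ne', cfRem_succ]
    rfl

theorem genContFract_of_get? (hα : Irrational α) (n : ℕ) :
    (GenContFract.of α).s.get? n = some ⟨1, cfQuot α n⟩ := by
  obtain ⟨b, hb⟩ := intFractPair_stream_eq hα n
  exact GenContFract.get?_of_eq_some_of_get?_intFractPair_stream_fr_ne_zero hb (cfRem_pos hα n).ne'

theorem convDenom_eq_cfDen (hα : Irrational α) (n : ℕ) : convDenom α n = cfDen α n := by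
  induction n using Nat.twoStepInduction with
  | zero => simp [convDenom, cfDen]
  | one =>
    rw [convDenom, GenContFract.first_den_eq (genContFract_of_get? hα 0)]
    rfl
  | more n h1 h2 =>
    rw [convDenom, GenContFract.dens_recurrence (genContFract_of_get? hα (n + 1)) h1 h2]
    simp [cfDen]

theorem cfErr_succ (hα : Irrational α) (n : ℕ) : cfErr α (n + 1) = -cfRem α (n + 1) * cfErr α n := by
  induction n with
  | zero =>
    have h1 := cfQuot_add_cfRem α 0
    have h2 := (cfRem_pos hα 0).ne'
    have h3 : cfRem α 0 = α - ⌊α⌋ := rfl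
    have h4 : cfQuot α 0 * cfRem α 0 = 1 - cfRem α 1 * cfRem α 0 := by
      field_simp at h1
      linarith
    simp only [cfErr, cfDen, cfNum]
    push_cast
    rw [one_mul, ← h3]
    linear_combination h4 - cfQuot α 0 * h3
  | succ n ih =>
    have h1 := cfQuot_add_cfRem α (n + 1)
    have h2 := (cfRem_pos hα (n + 1)).ne'
    have h4 : (cfQuot α (n + 1) + cfRem α (n + 2)) * cfRem α (n + 1) = 1 := by
      rw [h1, inv_mul_cancel₀ h2]
    have h5 : cfErr α (n + 2) = cfQuot α (n + 1) * cfErr α (n + 1) + cfErr α n := by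
      simp only [cfErr, cfDen, cfNum]
      push_cast
      ring
    rw [h5]
    linear_combination (cfQuot α (n + 1) + cfRem α (n + 2)) * ih - cfErr α n * h4

theorem cfDen_succ_eq (hα : Irrational α) (n : ℕ) :
    (cfDen α (n + 1) : ℝ) = cfDen α n * (cfQuot α n + cfRatio α n) := by
  induction n with
  | zero => simp [cfDen, cfRatio]
  | succ n ih =>
    have h1 : (0 : ℝ) < cfQuot α n + cfRatio α n := by
      have : (1 : ℝ) ≤ cfQuot α n := by exact_mod_cast one_le_cfQuot hα n
      linarith [cfRatio_nonneg hα n]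
    rw [cfRatio_succ, cfDen]
    push_cast
    rw [mul_add, ih, mul_inv_cancel_right₀ h1.ne']
    ring

/-- With the successor formula below, this expresses both ends of the k-th rectangle in the integral
through the orbit of `gaussExt`. -/
theorem cfDen_mul_abs_cfErr (hα : Irrational α) (n : ℕ) :
    cfDen α n * |cfErr α n| = cfRem α n / (1 + cfRem α n * cfRatio α n) := by
  induction n with
  | zero =>
    have h3 : cfErr α 0 = cfRem α 0 := by
      simp only [cfErr, cfDen, cfNum, Int.cast_one, one_mul]
      rfl
    rw [h3, abs_of_pos (cfRem_pos hα 0)]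
    simp [cfDen, cfRatio]
  | succ n ih =>
    have hx := cfRem_pos hα n
    have hx' := cfRem_pos hα (n + 1)
    have hv := cfRatio_nonneg hα n
    have ha : (1 : ℝ) ≤ cfQuot α n := by exact_mod_cast one_le_cfQuot hα n
    have hq : (cfQuot α n : ℝ) = (cfRem α n)⁻¹ - cfRem α (n + 1) := by
      rw [← cfQuot_add_cfRem]; ring
    have hs : (0 : ℝ) < cfQuot α n + cfRatio α n := by linarith
    -- Hence the induction hypothesis says that `q_n |q_n α - p_n|` is the inverse of `a_{n+1} + v_n
    -- + x_{n+1}`.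
    have h1 : 1 + cfRem α n * cfRatio α n =
        cfRem α n * (cfQuot α n + cfRatio α n + cfRem α (n + 1)) := by
      rw [hq]
      field_simp
      ring
    rw [h1, ← div_div, div_self hx.ne'] at ih
    rw [cfErr_succ hα, abs_mul, abs_neg, abs_of_pos hx', cfDen_succ_eq hα, cfRatio_succ]
    calc _ = (cfQuot α n + cfRatio α n) * cfRem α (n + 1) * (cfDen α n * |cfErr α n|) := by ring
      _ = _ := by
        rw [ih]
        field_simp

theorem cfDen_succ_mul_abs_cfErr (hα : Irrational α) (n : ℕ) :
    cfDen α (n + 1) * |cfErr α n| = 1 / (1 + cfRem α (n + 1) * cfRatio α (n + 1)) := by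
  have h := cfDen_mul_abs_cfErr hα (n + 1)
  have hx' := cfRem_pos hα (n + 1)
  rw [cfErr_succ hα, abs_mul, abs_neg, abs_of_pos hx', mul_left_comm, div_eq_mul_one_div] at h
  exact mul_left_cancel₀ hx'.ne' h

theorem cfNum_mul_cfDen_sub (α : ℝ) (n : ℕ) :
    cfNum α (n + 1) * cfDen α n - cfNum α n * cfDen α (n + 1) = (-1) ^ n := by
  induction n with
  | zero =>
    simp only [cfNum, cfDen]
    ring
  | succ n ih =>
    simp only [cfNum, cfDen]
    rw [pow_succ, ← ih]
    ring

/-- The law of best approximation: consecutive convergents form a basis of the integer lattice, and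
their errors have opposite signs. -/
theorem abs_cfErr_le (hα : Irrational α) {n : ℕ} {q p : ℤ} (hq : 1 ≤ q)
    (hqn : q < cfDen α (n + 1)) : |cfErr α n| ≤ |q * α - p| := by
  have hdet := cfNum_mul_cfDen_sub α n
  have hsq : ((-1 : ℤ) ^ n) * (-1) ^ n = 1 := by rw [← mul_pow]; simp
  -- Coordinates of `(q, p)` in the basis of the two convergents, by Cramer's rule with determinant
  -- `±1`.
  obtain ⟨u, hu⟩ : ∃ u, u = (-1) ^ n * (cfNum α (n + 1) * q - cfDen α (n + 1) * p) := ⟨_, rfl⟩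
  obtain ⟨v, hv⟩ : ∃ v, v = (-1) ^ n * (cfDen α n * p - cfNum α n * q) := ⟨_, rfl⟩
  have hq' : q = u * cfDen α n + v * cfDen α (n + 1) := by
    rw [hu, hv]
    linear_combination (-q) * hsq - (-1) ^ n * q * hdet
  have hp' : p = u * cfNum α n + v * cfNum α (n + 1) := by
    rw [hu, hv]
    linear_combination (-p) * hsq - (-1) ^ n * p * hdet
  have hD := cfDen_pos hα n
  have hD' := cfDen_pos hα (n + 1)
  have heq : (q : ℝ) * α - p = cfErr α n * (u - v * cfRem α (n + 1)) := by
    have h1 : (q : ℝ) * α - p = u * cfErr α n + v * cfErr α (n + 1) := by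
      rw [hq', hp']
      simp only [cfErr]
      push_cast
      ring
    rw [h1, cfErr_succ hα]
    ring
  have hx := cfRem_pos hα (n + 1)
  rw [heq, abs_mul]
  refine le_mul_of_one_le_right (abs_nonneg _) ?_
  -- The bounds `1 ≤ q < q_{n+1}` make `u` nonzero and of sign opposite to `v`, so `u` and `-v
  -- x_{n+1}` do not cancel.
  rcases lt_or_ge 0 v with h | h
  · have hu1 : u ≤ -1 := by
      by_contra! hcon
      have : 0 ≤ u := by omega
      nlinarith
    have h1 : (u : ℝ) ≤ -1 := by exact_mod_cast hu1
    have h2 : (0 : ℝ) < v := by exact_mod_cast h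
    exact le_abs.2 (Or.inr (by nlinarith))
  · have hu1 : 1 ≤ u := by
      by_contra! hcon
      have : u ≤ 0 := by omega
      nlinarith
    have h1 : (1 : ℝ) ≤ u := by exact_mod_cast hu1
    have h2 : (v : ℝ) ≤ 0 := by exact_mod_cast h
    exact le_abs.2 (Or.inl (by nlinarith))

theorem irrMeasure_eq (hα : Irrational α) {n : ℕ} {t : ℝ} (h1 : cfDen α n ≤ t)
    (h2 : t < cfDen α (n + 1)) : irrMeasure α t = |cfErr α n| := by
  refine IsLeast.csInf_eq ⟨?_, ?_⟩
  · obtain ⟨m, hm⟩ := Int.eq_ofNat_of_zero_le (cfDen_pos hα n).le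
    have hpos := cfDen_pos hα n
    have hlt : cfDen α n < cfDen α (n + 1) := by exact_mod_cast h1.trans_lt h2
    have hm' : ((m : ℕ) : ℝ) = cfDen α n := by rw [hm]; simp
    refine ⟨m, ⟨by omega, by rwa [hm']⟩, ?_⟩
    simp only [distNearestInt, hm']
    exact le_antisymm (round_le _ _) (abs_cfErr_le hα hpos hlt)
  · rintro _ ⟨q, ⟨hq1, hq2⟩, rfl⟩
    have hlt : (q : ℤ) < cfDen α (n + 1) := by exact_mod_cast hq2.trans_lt h2
    have := abs_cfErr_le hα (p := round ((q : ℝ) * α)) (by exact_mod_cast hq1) hlt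
    simpa [distNearestInt] using this

end Irrational

/-! ### The integral and the logarithm as Birkhoff sums -/

section Integral

variable {α : ℝ}

theorem cfDen_mono (hα : Irrational α) : Monotone fun n => (cfDen α n : ℝ) := fun m n h => by
  simpa only [← convDenom_eq_cfDen hα] using convDenom_mono α h

theorem integral_irrMeasure_eq (hα : Irrational α) {n : ℕ} {t : ℝ} (h1 : cfDen α n ≤ t)
    (h2 : t ≤ cfDen α (n + 1)) :
    IntervalIntegrable (irrMeasure α) volume (cfDen α n) t ∧
      ∫ ξ in (cfDen α n : ℝ)..t, irrMeasure α ξ = (t - cfDen α n) * |cfErr α n| := by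
  -- An open interval, since `t = q_{n+1}` is allowed and the value jumps there.
  have heq : ∀ ξ ∈ Set.Ioo (cfDen α n : ℝ) t, irrMeasure α ξ = |cfErr α n| := fun ξ hξ =>
    irrMeasure_eq hα hξ.1.le (hξ.2.trans_le h2)
  constructor
  · refine (intervalIntegrable_congr_uIoo ?_).2 (intervalIntegrable_const (c := |cfErr α n|))
    rwa [Set.uIoo_of_le h1]
  · rw [intervalIntegral.integral_congr_Ioo_of_le h1 heq, intervalIntegral.integral_const,
      smul_eq_mul]

theorem irrMeasureIntegral_cfDen (hα : Irrational α) (n : ℕ) :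
    IntervalIntegrable (irrMeasure α) volume 1 (cfDen α n) ∧ irrMeasureIntegral α (cfDen α n) =
      ∑ k ∈ Finset.range n, ((cfDen α (k + 1) : ℝ) - cfDen α k) * |cfErr α k| := by
  induction n with
  | zero => simp [irrMeasureIntegral, cfDen]
  | succ n ih =>
    have h := integral_irrMeasure_eq hα (cfDen_mono hα n.le_succ) le_rfl
    refine ⟨ih.1.trans h.1, ?_⟩
    rw [Finset.sum_range_succ, ← ih.2, ← h.2]
    exact (intervalIntegral.integral_add_adjacent_intervals ih.1 h.1).symm

theorem inv_one_add_cfRem_mul_cfRatio_mem (hα : Irrational α) (n : ℕ) :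
    1 / (1 + cfRem α n * cfRatio α n) ∈ Set.Icc (0 : ℝ) 1 := by
  have := mul_nonneg (cfRem_pos hα n).le (cfRatio_nonneg hα n)
  exact ⟨by positivity, div_le_one_of_le₀ (by linarith) (by positivity)⟩

/-- The k-th term is `1/(1 + x_{k+1} v_{k+1}) - x_k/(1 + x_k v_k)`; replacing the first index `k +
1` by `k` gives the observable and leaves a telescoping sum. -/
theorem sum_eq_birkhoffSum (hα : Irrational α) (n : ℕ) :
    ∑ k ∈ Finset.range n, ((cfDen α (k + 1) : ℝ) - cfDen α k) * |cfErr α k| =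
      birkhoffSum gaussExt (fun p : ℝ × ℝ => (1 - p.1) / (1 + p.1 * p.2)) n (Int.fract α, 0) +
        (1 / (1 + cfRem α n * cfRatio α n) - 1 / (1 + cfRem α 0 * cfRatio α 0)) := by
  rw [← Finset.sum_range_sub (fun n => 1 / (1 + cfRem α n * cfRatio α n)), birkhoffSum,
    ← Finset.sum_add_distrib]
  refine Finset.sum_congr rfl fun k _ => ?_
  rw [gaussExt_iterate, sub_mul, cfDen_succ_mul_abs_cfErr hα, cfDen_mul_abs_cfErr hα]
  ring

theorem log_cfDen (hα : Irrational α) (n : ℕ) :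
    Real.log (cfDen α n) =
      birkhoffSum gaussExt (fun p : ℝ × ℝ => Real.log (⌊p.1⁻¹⌋ + p.2)) n (Int.fract α, 0) := by
  induction n with
  | zero => simp [cfDen]
  | succ n ih =>
    have h1 : (0 : ℝ) < cfDen α n := by exact_mod_cast cfDen_pos hα n
    have h2 : (1 : ℝ) ≤ cfQuot α n := by exact_mod_cast one_le_cfQuot hα n
    have h3 := cfRatio_nonneg hα n
    rw [birkhoffSum_succ, ← ih, gaussExt_iterate, cfDen_succ_eq hα,
      Real.log_mul h1.ne' (by positivity)]
    rfl

theorem abs_irrMeasureIntegral_sub_le (hα : Irrational α) {n : ℕ} {t : ℝ} (h1 : cfDen α n ≤ t)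
    (h2 : t < cfDen α (n + 1)) :
    |irrMeasureIntegral α t - birkhoffSum gaussExt
      (fun p : ℝ × ℝ => (1 - p.1) / (1 + p.1 * p.2)) n (Int.fract α, 0)| ≤ 2 := by
  have h3 := irrMeasureIntegral_cfDen hα n
  have h4 := integral_irrMeasure_eq hα h1 h2.le
  have h5 : irrMeasureIntegral α t =
      irrMeasureIntegral α (cfDen α n) + (t - cfDen α n) * |cfErr α n| := by
    rw [← h4.2]
    exact (intervalIntegral.integral_add_adjacent_intervals h3.1 h4.1).symm
  rw [h5, h3.2, sum_eq_birkhoffSum hα]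
  have h6 := inv_one_add_cfRem_mul_cfRatio_mem hα n
  have h7 := inv_one_add_cfRem_mul_cfRatio_mem hα 0
  have h8 : 0 ≤ (t - cfDen α n) * |cfErr α n| :=
    mul_nonneg (by linarith) (abs_nonneg _)
  -- The incomplete last rectangle is at most `q_{n+1} |q_n α - p_n| ≤ 1`; with the telescoped
  -- endpoints in `[0, 1]`, the total error lies in `[-1, 2]`.
  have h9 : (t - cfDen α n) * |cfErr α n| ≤ 1 := by
    refine le_trans ?_ (inv_one_add_cfRem_mul_cfRatio_mem hα (n + 1)).2
    rw [← cfDen_succ_mul_abs_cfErr hα]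
    have : (0 : ℝ) < cfDen α n := by exact_mod_cast cfDen_pos hα n
    exact mul_le_mul_of_nonneg_right (by linarith) (abs_nonneg _)
  rw [abs_le]
  constructor <;> linarith [h6.1, h6.2, h7.1, h7.2]

theorem tendsto_convIndex (hα : Irrational α) : Tendsto (convIndex α) atTop atTop := by
  refine tendsto_atTop.2 fun m => ?_
  filter_upwards [eventually_ge_atTop 1, eventually_ge_atTop (convDenom α m)] with t ht1 htm
  by_contra! h
  have h1 := (convIndex_spec hα ht1).2
  exact absurd (h1.trans_le (convDenom_mono α h)) (not_lt.2 htm)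

theorem tendsto_irrMeasureIntegral_div_convIndex (hα : Irrational α)
    (h : Tendsto (fun n : ℕ => birkhoffSum gaussExt
        (fun p : ℝ × ℝ => (1 - p.1) / (1 + p.1 * p.2)) n (Int.fract α, 0) / n) atTop (𝓝 (1 / 2))) :
    Tendsto (fun t : ℝ => irrMeasureIntegral α t / (convIndex α t : ℝ)) atTop (𝓝 (1 / 2)) := by
  have hN := tendsto_convIndex hα
  have h1 := h.comp hN
  have h2 : Tendsto (fun t : ℝ => 2 / (convIndex α t : ℝ)) atTop (𝓝 0) :=
    tendsto_const_nhds.div_atTop (tendsto_natCast_atTop_atTop.comp hN)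
  have h3 : Tendsto (fun t : ℝ => irrMeasureIntegral α t / (convIndex α t : ℝ) -
      birkhoffSum gaussExt (fun p : ℝ × ℝ => (1 - p.1) / (1 + p.1 * p.2))
        (convIndex α t) (Int.fract α, 0) / (convIndex α t : ℝ)) atTop (𝓝 0) := by
    refine squeeze_zero_norm' ?_ h2
    filter_upwards [eventually_ge_atTop 1] with t ht
    have hs := convIndex_spec hα ht
    rw [convDenom_eq_cfDen hα, convDenom_eq_cfDen hα] at hs
    rw [← sub_div, norm_div, RCLike.norm_natCast, Real.norm_eq_abs]
    exact div_le_div_of_nonneg_right (abs_irrMeasureIntegral_sub_le hα hs.1 hs.2)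
      (Nat.cast_nonneg _)
  have h4 := h3.add h1
  rw [zero_add] at h4
  exact h4.congr fun t => by simp

theorem tendsto_log_div_convIndex (hα : Irrational α) {c : ℝ}
    (h : Tendsto (fun n : ℕ => birkhoffSum gaussExt
        (fun p : ℝ × ℝ => Real.log (⌊p.1⁻¹⌋ + p.2)) n (Int.fract α, 0) / n) atTop (𝓝 c)) :
    Tendsto (fun t : ℝ => Real.log t / (convIndex α t : ℝ)) atTop (𝓝 c) := by
  simp only [← log_cfDen hα] at h
  have hN := tendsto_convIndex hα
  -- Upper half of the squeeze `q_N ≤ t < q_{N+1}`; the factor `1 + 1/n` corrects the denominator `n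
  -- + 1` to `n`.
  have h1 : Tendsto (fun n : ℕ => Real.log (cfDen α (n + 1)) / n) atTop (𝓝 c) := by
    have h2 := (h.comp (tendsto_add_atTop_nat 1)).mul
      (tendsto_const_nhds.add (tendsto_one_div_atTop_nhds_zero_nat (𝕜 := ℝ)) :
        Tendsto (fun n : ℕ => (1 : ℝ) + 1 / n) atTop (𝓝 (1 + 0)))
    rw [add_zero, mul_one] at h2
    refine h2.congr' ?_
    filter_upwards [eventually_gt_atTop 0] with n hn
    have : (0 : ℝ) < n := by exact_mod_cast hn
    simp only [Function.comp_apply]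
    push_cast
    field_simp
  refine tendsto_of_tendsto_of_tendsto_of_le_of_le' (h.comp hN) (h1.comp hN) ?_ ?_
  all_goals
    filter_upwards [eventually_ge_atTop 1] with t ht
    have hs := convIndex_spec hα ht
    rw [convDenom_eq_cfDen hα, convDenom_eq_cfDen hα] at hs
    refine div_le_div_of_nonneg_right ?_ (Nat.cast_nonneg _)
  · exact Real.log_le_log (by exact_mod_cast cfDen_pos hα _) hs.1
  · exact Real.log_le_log (by linarith) hs.2.le

theorem tendsto_irrMeasureIntegral_div_log (hα : Irrational α)
    (h1 : Tendsto (fun t : ℝ => irrMeasureIntegral α t / (convIndex α t : ℝ)) atTop (𝓝 (1 / 2)))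
    (h2 : Tendsto (fun t : ℝ => Real.log t / (convIndex α t : ℝ)) atTop
      (𝓝 (Real.pi ^ 2 / (12 * Real.log 2)))) :
    Tendsto (fun t : ℝ => irrMeasureIntegral α t / Real.log t) atTop
      (𝓝 (6 * Real.log 2 / Real.pi ^ 2)) := by
  have hl : 0 < Real.log 2 := Real.log_pos one_lt_two
  have h3 := h1.div h2 (by positivity)
  have h4 : 1 / 2 / (Real.pi ^ 2 / (12 * Real.log 2)) = 6 * Real.log 2 / Real.pi ^ 2 := by
    field_simp
    norm_num
  rw [h4] at h3
  refine h3.congr' ?_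
  filter_upwards [(tendsto_convIndex hα).eventually_gt_atTop 0] with t ht
  have : (0 : ℝ) < convIndex α t := by exact_mod_cast ht
  simp only [Pi.div_apply]
  exact div_div_div_cancel_right₀ this.ne' _ _

end Integral

/-! ### From the unit interval to the real line -/

/-- Countably many integer translates of a null set are null, and `Int.fract α` is one of the
translates of `α`. -/
theorem ae_fract_of_ae_restrict_Ioo {P : ℝ → Prop}
    (h : ∀ᵐ x ∂(volume.restrict (Set.Ioo (0 : ℝ) 1)), P x) :
    ∀ᵐ α : ℝ, Irrational α ∧ P (Int.fract α) := by
  rw [ae_restrict_iff' measurableSet_Ioo] at h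
  have h1 : ∀ᵐ α : ℝ, ∀ m : ℤ, α - m ∈ Set.Ioo (0 : ℝ) 1 → P (α - m) := ae_all_iff.2 fun m =>
    (measurePreserving_sub_right volume (m : ℝ)).quasiMeasurePreserving.ae h
  have h2 : ∀ᵐ α : ℝ, Irrational α := (Set.countable_range ((↑) : ℚ → ℝ)).ae_notMem volume
  filter_upwards [h1, h2] with α hα hi
  exact ⟨hi, hα ⌊α⌋ (cfRem_mem hi 0).1⟩

theorem theorem1 :
    ∀ᵐ α : ℝ ∂(volume : Measure ℝ),
      Tendsto (fun t : ℝ => irrMeasureIntegral α t / (convIndex α t : ℝ)) atTop (𝓝 (1 / 2)) ∧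
      Tendsto (fun t : ℝ => irrMeasureIntegral α t / Real.log t) atTop
        (𝓝 (6 * Real.log 2 / Real.pi ^ 2)) := by
  filter_upwards [ae_fract_of_ae_restrict_Ioo ae_tendsto_birkhoffSum_one_sub_div,
    ae_fract_of_ae_restrict_Ioo ae_tendsto_birkhoffSum_log] with α h1 h2
  have h3 := tendsto_irrMeasureIntegral_div_convIndex h1.1 h1.2
  exact ⟨h3, tendsto_irrMeasureIntegral_div_log h1.1 h3 (tendsto_log_div_convIndex h1.1 h2.2)⟩
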